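/- Call a graph-with-player instance a tuple consisting of a finite undirected simple graph $G=(N,E)$, a weight function $w:E\to\mathbb{Q}_{\ge 0}$ and a player $i\in N$. The matching game on $(G,w)$ is the cooperative game $(N,v)$ in which, for every coalition $S\subseteq N$, $v(S)$ is the weight of a maximum weight matching of the subgraph of $G$ induced by $S$. The Shapley value of player $i$ is $$\varphi_i(N,v)=\frac{1}{|N|!}\sum_{S\subseteq N\setminus\{i\}}|S|!\,(|N|-|S|-1)!\,\bigl(v(S\cup\{i\})-v(S)\bigr).$$ Theorem. On graphs of maximum degree at most two, the Shapley value of a matching game can be computed in polynomial time. That is, there is a (multi-stack) Turing machine which, given any instance $(G,w,i)$ in which every vertex of $G$ has degree at most two, written as a string over a fixed finite alphabet (a list of the vertices with the player $i$ marked, followed by the weighted adjacency matrix, whose entries are reduced fractions in binary), halts with output natural numbers $p$ and $q\neq 0$, written in binary, such that $\varphi_i(N,v)=p/q$, after a number of steps bounded by a fixed polynomial in the length of the input. In particular this holds for unweighted graphs, where all weights are $1$. -/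

import Mathlib

open scoped NNReal Nat

noncomputable section

namespace MatchingGame

/-- The Shapley value of player `i` in the cooperative game with player set `N` and
characteristic function `v`:
`φ_i(N, v) = (∑_{S ⊆ N ∖ {i}} |S|! (|N| - |S| - 1)! (v (S ∪ {i}) - v S)) / |N|!`. -/
def shapleyValue {N : Type*} [Fintype N] [DecidableEq N] (v : Finset N → ℝ) (i : N) : ℝ :=
  (∑ S ∈ (Finset.univ.erase i).powerset,
      (S.card ! : ℝ) * ((Fintype.card N - S.card - 1)! : ℝ) * (v (insert i S) - v S))
    / (Fintype.card N)!

/-- `M` is a matching of the subgraph `G(S)` induced by `S`: every edge in `M` has both ends in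
`S`, and distinct edges in `M` have no vertex in common. -/
def IsMatchingOn {N : Type*} (G : SimpleGraph N) (S : Finset N) (M : Finset G.edgeSet) : Prop :=
  (∀ e ∈ M, ∀ x ∈ (e : Sym2 N), x ∈ S) ∧
    ∀ e ∈ M, ∀ e' ∈ M, e ≠ e' → ∀ x ∈ (e : Sym2 N), x ∉ (e' : Sym2 N)

open Classical in
/-- The characteristic function of the matching game `MG(G)`: `v(S)` is the weight of a maximum
weight matching of `G(S)`. The family over which the maximum is taken is finite, contains the
empty matching, and all weights are nonnegative, so the supremum in `ℝ≥0` is that maximum. -/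
def matchingGame {N : Type*} [Fintype N] (G : SimpleGraph N) (w : G.edgeSet → ℝ≥0)
    (S : Finset N) : ℝ :=
  (((Finset.univ.filter (IsMatchingOn G S)).sup fun M => ∑ e ∈ M, w e : ℝ≥0) : ℝ)

/-- An instance of the problem SHAPLEY: a finite undirected graph with nonnegative edge weights,
and a specified player. Weights given to an algorithm are rational. -/
structure Instance where
  /-- number of vertices -/
  n : ℕ
  graph : SimpleGraph (Fin n)
  weight : graph.edgeSet → ℚ≥0
  player : Fin n

/-- The answer to an instance of SHAPLEY. -/
def Instance.answer (I : Instance) : ℝ :=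
  shapleyValue (matchingGame I.graph fun e => (I.weight e : ℝ≥0)) I.player

open Classical in
/-- Every vertex of the graph has degree at most two. -/
def Instance.MaxDegreeLeTwo (I : Instance) : Prop :=
  ∀ x, I.graph.degree x ≤ 2

/-- The alphabet in which inputs and outputs are written. -/
inductive Symbol where
  | bit (b : Bool)
  | slash
  | vertex
  | player
  | nonEdge
  | endEntry
  | endRow
  deriving DecidableEq, Fintype

/-- Binary notation of a natural number, least significant bit first. -/
def encodeNat (k : ℕ) : List Symbol :=
  k.bits.map Symbol.bit

/-- A fraction of two natural numbers, written as `p/q` in binary. -/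
def encodeFraction (x : ℕ × ℕ) : List Symbol :=
  encodeNat x.1 ++ Symbol.slash :: encodeNat x.2

open Classical in
/-- The entry at position `(x, y)` of the weighted adjacency matrix: the weight of the edge
`{x, y}` as a fraction in lowest terms, or a mark that there is no such edge. -/
def Instance.encodeEntry (I : Instance) (x y : Fin I.n) : List Symbol :=
  (if h : s(x, y) ∈ I.graph.edgeSet then
      encodeFraction ((I.weight ⟨s(x, y), h⟩).num, (I.weight ⟨s(x, y), h⟩).den)
    else [Symbol.nonEdge]) ++ [Symbol.endEntry]

/-- The input string: one symbol for every vertex, which says whether it is the specified player,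
and then the rows of the weighted adjacency matrix. -/
def Instance.encode (I : Instance) : List Symbol :=
  ((List.finRange I.n).map fun x => if x = I.player then Symbol.player else Symbol.vertex) ++
    (List.finRange I.n).flatMap fun x =>
      ((List.finRange I.n).flatMap fun y => I.encodeEntry x y) ++ [Symbol.endRow]

end MatchingGame

end

/-! ### A structured language of stack programs and its compilation to Turing machines -/

namespace StackProg

open MatchingGame (Symbol)
open Function (update)

/-! For `i ∉ S` write m_S(i) = v(S ∪ {i}) − v(S). An optimal matching of S ∪ {i} either misses i, or
uses an edge iy with y ∈ S and is otherwise a matching of S \ {y}. Since v(S) = v(S \ {y}) + m_{S \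
{y}}(y), this gives m_S(i) = max(0, max_y (w(iy) − m_{S \ {y}}(y))), where y runs over the
neighbours of i in S (`sub_marginal_le`, `marginal_le`).

If all degrees are at most two, a vertex reached from i has at most one neighbour that has not been
visited yet. The recursion therefore runs along two paths leaving i, the arms, and stops at the
first vertex outside S. So m_S(i) is the larger of two gains, each determined by the initial segment
of one arm that lies in S (`Represents.marginal_eq_max_gainVal`). On a cycle the arms go all the way
round in opposite directions; the edge closing the cycle does no harm because i is not in S.

The initial segment in S is exactly the first k vertices when these lie in S but the first k + 1 do
not, and its indicator is a difference of two indicators. Hence m_S(i) is a signed sum of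
quadratically many constants times indicators of X ⊆ S, with X a union of two initial segments
(`sum_signedPrefixes`). Under the Shapley weights, X ⊆ S has probability 1/(|X| + 1): player i must
come last among X ∪ {i} in a random order (`sum_coalitions`). The Shapley value becomes an explicit
sum of fractions (`Represents.solveEdges_spec`).

For the running time, a small language of stack programs is compiled to Turing machines
(`Exec.steps`, `Prog.computable`). Data are written as binary trees, and `PolyTime` functions are
closed under composition, pairing, case distinction and folds whose intermediate results stay
polynomially small (`PolyTime.foldl`). The algorithm `solve` is built from these operations. Its
fractions are never reduced, but bit lengths only add up under multiplication, so they stay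
polynomial. -/

/-- Names of the four stacks used by the programs. -/
inductive Stack
  | a | b | c | d
  deriving DecidableEq

instance : Fintype Stack :=
  ⟨{.a, .b, .c, .d}, fun k => by cases k <;> simp⟩

/-- The contents of all stacks. -/
abbrev Store := Stack → List Symbol

/-- Structured programs working on four stacks. -/
inductive Prog
  /-- push a symbol -/
  | push (k : Stack) (s : Symbol)
  /-- pop a symbol from `k` and push it on every stack selected by `t` -/
  | move (k : Stack) (t : Stack → Bool)
  /-- sequential composition -/
  | seq (p q : Prog)
  /-- case distinction on the top of a stack -/
  | branch (k : Stack) (f : Option Symbol → Prog)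
  /-- repeat while the top of a stack passes a test -/
  | loop (k : Stack) (test : Option Symbol → Bool) (p : Prog)

/-- `Exec p S S' t`: program `p` started with stacks `S` ends with stacks `S'` after `t` steps. -/
inductive Exec : Prog → Store → Store → ℕ → Prop
  | push (k s S) : Exec (.push k s) S (update S k (s :: S k)) 1
  | move (k t S s l) (h : S k = s :: l) : Exec (.move k t) S
      (fun j => if t j then s :: update S k l j else update S k l j) 1
  | seq {p q S S' S'' t t'} (h : Exec p S S' t) (h' : Exec q S' S'' t') :
      Exec (.seq p q) S S'' (t + t')
  | branch {k f S S' t} (h : Exec (f (S k).head?) S S' t) : Exec (.branch k f) S S' (t + 1)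
  | loop_done {k test p S} (h : test (S k).head? = false) : Exec (.loop k test p) S S 1
  | loop_next {k test p S S' S'' t t'} (h : test (S k).head? = true) (hp : Exec p S S' t)
      (hl : Exec (.loop k test p) S' S'' t') : Exec (.loop k test p) S S'' (t + t' + 1)

/-- No instruction pushes more than one symbol on any one stack. A time bound thus bounds the size
of the result. -/
theorem Exec.length_le {p S S' t} (h : Exec p S S' t) (k : Stack) :
    (S' k).length ≤ (S k).length + t := by
  induction h with
  | push j s S =>
    by_cases hk : k = j
    · subst hk; simp
    · simp [Function.update_of_ne hk]
  | move j t S s l h =>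
    by_cases hk : k = j
    · subst hk
      dsimp only
      split_ifs <;> simp [h]
      omega
    · dsimp only
      split_ifs <;> simp [Function.update_of_ne hk]
  | seq _ _ ih ih' => omega
  | branch _ ih => omega
  | loop_done _ => omega
  | loop_next _ _ _ ih ih' => omega

namespace Prog

/-- Control positions of a program. -/
def Label : Prog → Type
  | push _ _ => Unit
  | move _ _ => Unit
  | seq p q => p.Label ⊕ q.Label
  | branch _ f => Option (Σ o, (f o).Label)
  | loop _ _ p => Option p.Label

/-- There are finitely many control positions. -/
@[reducible] def labelFintype : ∀ p : Prog, Fintype p.Label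
  | push _ _ => inferInstanceAs (Fintype Unit)
  | move _ _ => inferInstanceAs (Fintype Unit)
  | seq p q =>
    letI := labelFintype p
    letI := labelFintype q
    inferInstanceAs (Fintype (p.Label ⊕ q.Label))
  | branch _ f =>
    letI := fun o => labelFintype (f o)
    inferInstanceAs (Fintype (Option (Σ o, (f o).Label)))
  | loop _ _ p =>
    letI := labelFintype p
    inferInstanceAs (Fintype (Option p.Label))

/-- The first control position. -/
def entry : ∀ p : Prog, p.Label
  | push _ _ => ()
  | move _ _ => ()
  | seq p _ => Sum.inl p.entry
  | branch _ _ => none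
  | loop _ _ _ => none

/-- Statements of the Turing machines which run programs. -/
abbrev MStmt (Λ : Type) := Turing.TM2.Stmt (fun _ : Stack => Symbol) Λ (Option Symbol)

/-- Push the remembered symbol if the flag is set. -/
def pushIf {Λ : Type} (f : Bool) (k : Stack) (q : MStmt Λ) : MStmt Λ :=
  -- The default is never pushed in a run described by `Exec`, which has no rule for moving from an
  -- empty stack.
  if f then .push k (fun v => v.getD .slash) q else q

/-- The machine code of a program, given an embedding of its control positions and the position
to continue with. -/
def compile {Λ : Type} : ∀ p : Prog, (p.Label → Λ) → Λ → p.Label → MStmt Λ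
  | push k s, _, exit, _ => .push k (fun _ => s) (.goto fun _ => exit)
  | move k t, _, exit, _ => .pop k (fun _ o => o) (pushIf (t .a) .a (pushIf (t .b) .b
      (pushIf (t .c) .c (pushIf (t .d) .d (.goto fun _ => exit)))))
  | seq p q, emb, exit, l =>
    match l with
    | .inl l => p.compile (fun l => emb (.inl l)) (emb (.inr q.entry)) l
    | .inr l => q.compile (fun l => emb (.inr l)) exit l
  | branch k f, emb, exit, l =>
    match l with
    | none => .peek k (fun _ o => o) (.goto fun o => emb (some ⟨o, (f o).entry⟩))
    | some ⟨o, l⟩ => (f o).compile (fun l => emb (some ⟨o, l⟩)) exit l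
  | loop k test p, emb, exit, l =>
    match l with
    | none => .peek k (fun _ o => o)
        (.goto fun o => if test o then emb (some p.entry) else exit)
    | some l => p.compile (fun l => emb (some l)) (emb none) l

end Prog

/-- Configurations of the machines which run programs. -/
abbrev MCfg (Λ : Type) := Turing.TM2.Cfg (fun _ : Stack => Symbol) Λ (Option Symbol)

/-- The machine goes from one configuration to another one in exactly `t` steps. -/
def Steps {Λ : Type} (m : Λ → Prog.MStmt Λ) (t : ℕ) (c c' : MCfg Λ) : Prop :=
  (flip bind (Turing.TM2.step m))^[t] (some c) = some c'

theorem Steps.trans {Λ : Type} {m : Λ → Prog.MStmt Λ} {t t' : ℕ} {c c' c'' : MCfg Λ}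
    (h : Steps m t c c') (h' : Steps m t' c' c'') : Steps m (t + t') c c'' := by
  unfold Steps at *
  rw [add_comm, Function.iterate_add_apply, h, h']

theorem Steps.one {Λ : Type} (m : Λ → Prog.MStmt Λ) (l : Λ) (v : Option Symbol) (S : Store) :
    Steps m 1 ⟨some l, v, S⟩ (Turing.TM2.stepAux (m l) v S) := rfl

/-- Induction on the run. `emb` and `exit` are arbitrary so that a subprogram can be followed inside
the machine of a larger one. The memory `v` is arbitrary because every instruction that uses it
overwrites it before. -/
theorem Exec.steps {Λ : Type} {m : Λ → Prog.MStmt Λ} {p S S' t} (h : Exec p S S' t) :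
    ∀ (emb : p.Label → Λ) (exit : Λ) (_ : ∀ l, m (emb l) = p.compile emb exit l)
      (v : Option Symbol),
      ∃ v', Steps m t ⟨some (emb p.entry), v, S⟩ ⟨some exit, v', S'⟩ := by
  induction h with
  | push k s S =>
    intro emb exit hm v
    have := Steps.one m (emb (Prog.push k s).entry) v S
    rw [hm] at this
    exact ⟨_, this⟩
  | move k t S s l h =>
    intro emb exit hm v
    have := Steps.one m (emb (Prog.move k t).entry) v S
    rw [hm] at this
    refine ⟨some s, ?_⟩
    convert! this using 1
    rw [Prog.compile, Turing.TM2.stepAux, h]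
    have key : ∀ (f : Bool) (j : Stack) (q : Prog.MStmt Λ) (S : Store),
        Turing.TM2.stepAux (Prog.pushIf f j q) (some s) S =
          Turing.TM2.stepAux q (some s) (if f then update S j (s :: S j) else S) := by
      intro f j q S
      cases f <;> simp [Prog.pushIf]
    simp only [List.head?_cons, List.tail_cons, key, Turing.TM2.stepAux]
    congr 1
    funext j
    cases j <;> cases t .a <;> cases t .b <;> cases t .c <;> cases t .d <;> simp [update]
  | @seq p q S S' S'' t t' _ _ ih ih' =>
    intro emb exit hm v
    obtain ⟨v', h₁⟩ := ih (fun l => emb (.inl l)) (emb (.inr q.entry)) (fun l => hm (.inl l)) v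
    obtain ⟨v'', h₂⟩ := ih' (fun l => emb (.inr l)) exit (fun l => hm (.inr l)) v'
    exact ⟨v'', h₁.trans h₂⟩
  | @branch k f S S' t _ ih =>
    intro emb exit hm v
    obtain ⟨v', h₁⟩ := ih (fun l => emb (some ⟨_, l⟩)) exit (fun l => hm (some ⟨_, l⟩))
      (S k).head?
    have := Steps.one m (emb none) v S
    rw [show m (emb none) = _ from hm none] at this
    rw [add_comm]
    exact ⟨v', this.trans h₁⟩
  | @loop_done k test p S h =>
    intro emb exit hm v
    have := Steps.one m (emb none) v S
    rw [show m (emb none) = _ from hm none, Prog.compile, Turing.TM2.stepAux, Turing.TM2.stepAux, h] at this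
    exact ⟨_, this⟩
  | @loop_next k test p S S' S'' t t' h _ _ ih ih' =>
    intro emb exit hm v
    have := Steps.one m (emb none) v S
    rw [show m (emb none) = _ from hm none, Prog.compile, Turing.TM2.stepAux, Turing.TM2.stepAux, h] at this
    obtain ⟨v', h₁⟩ := ih (fun l => emb (some l)) (emb none) (fun l => hm (some l)) (S k).head?
    obtain ⟨v'', h₂⟩ := ih' emb exit hm v'
    rw [show t + t' + 1 = 1 + (t + t') by ring]
    exact ⟨v'', this.trans (h₁.trans h₂)⟩

/-- The Turing machine running a program, with input and output on the first stack. -/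
def Prog.machine (p : Prog) : Turing.FinTM2 where
  K := Stack
  k₀ := .a
  k₁ := .a
  Γ _ := Symbol
  Λ := Option p.Label
  main := some p.entry
  ΛFin := letI := p.labelFintype; inferInstanceAs (Fintype (Option p.Label))
  σ := Option Symbol
  initialState := none
  Γk₀Fin := inferInstanceAs (Fintype Symbol)
  m
    -- A halting configuration must carry the initial memory. This last step is the `+ 1` in the
    -- time bound of `Prog.computable`.
    | none => .load (fun _ => none) .halt
    | some l => p.compile some none l

/-- The store with the given contents of the four stacks. -/
def store (A B C D : List Symbol) : Store
  | .a => A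
  | .b => B
  | .c => C
  | .d => D

/-- A program which computes a function on strings in polynomial time gives a Turing machine. -/
theorem Prog.computable {α β : Type} {ea : α → List Symbol} {eb : β → List Symbol} {f : α → β}
    (p : Prog) (P : Polynomial ℕ)
    (h : ∀ x, ∃ t ≤ P.eval (ea x).length,
      Exec p (store (ea x) [] [] []) (store (eb (f x)) [] [] []) t) :
    Nonempty (Turing.TM2ComputableInPolyTime ea eb f) := by
  refine ⟨⟨⟨p.machine, Equiv.refl _, Equiv.refl _⟩, P + 1, fun x => Classical.choice ?_⟩⟩
  obtain ⟨t, ht, hx⟩ := h x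
  obtain ⟨v, hv⟩ := hx.steps (m := p.machine.m) some none (fun l => rfl) none
  have h2 := hv.trans (Steps.one _ _ _ _)
  refine ⟨⟨⟨t + 1, ?_⟩, ?_⟩⟩
  · unfold Steps at h2
    convert! h2 using 2
    · congr 1
      simp only [Turing.initList]
      congr 1
      funext k
      cases k <;> simp [store, Prog.machine]
      rfl
    · simp only [Turing.haltList, Option.map]
      congr 1
      simp only [Prog.machine, Turing.TM2.stepAux]
      congr 1
      funext k
      cases k <;> simp [store]
      rfl
  · simpa using ht

end StackProg

/-! ### Functions computed in polynomial time -/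

namespace StackProg

open MatchingGame (Symbol)
open Function (update)

theorem Exec.congr {p S S' S'' t t'} (h : Exec p S S' t) (hS : S' = S'') (ht : t = t') :
    Exec p S S'' t' := hS ▸ ht ▸ h

theorem Exec.congr' {p S S' S₀ t} (h : Exec p S S' t) (hS : S₀ = S) :
    Exec p S₀ S' t := hS ▸ h

/-- Binary trees, the data on which programs work. -/
inductive BTree
  | nil
  | cons (x y : BTree)
  deriving DecidableEq

/-- Self-delimiting notation for trees. -/
def BTree.code : BTree → List Symbol
  | nil => [.bit false]
  | cons x y => .bit true :: (x.code ++ y.code)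

/-- A slash can therefore mark the bottom of a tree parked on another stack; `back` stops exactly
there. -/
theorem BTree.slash_notMem_code (x : BTree) : Symbol.slash ∉ x.code := by
  induction x with
  | nil => simp [code]
  | cons x y ihx ihy => simp [code, ihx, ihy]

theorem BTree.code_length_pos (x : BTree) : 0 < x.code.length := by
  cases x <;> simp [code]

namespace Prog

/-- Pop a symbol and forget it. -/
abbrev drop (k : Stack) : Prog := .move k fun _ => false

/-- Do nothing. -/
abbrev nop : Prog := .loop .a (fun _ => false) (drop .a)

/-- The targets of `readTree`. -/
def targets (gb gd : Bool) : Stack → Bool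
  | .b => gb
  | .d => gd
  | _ => false

/-- The main loop of `readTree`. -/
def readLoop (gb gd : Bool) : Prog :=
  .loop .c (fun o => o = some .vertex)
    (.branch .a fun o =>
      .seq (if o = some (.bit true) then .push .c .vertex else drop .c) (.move .a (targets gb gd)))

/-- Pop a tree from the first stack; optionally push its notation, in reverse, on other stacks. -/
def readTree (gb gd : Bool) : Prog :=
  .seq (.push .c .slash) (.seq (.push .c .vertex) (.seq (readLoop gb gd) (drop .c)))

/-- Move everything above a mark back to the first stack, and remove the mark. -/
def back (k : Stack) : Prog :=
  .seq (.loop k (fun o => o ≠ some .slash) (.move k (fun j => j = .a))) (drop k)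

/-- Move a tree to the second stack. -/
def stash : Prog := .seq (.push .b .slash) (readTree true false)

/-- Duplicate a tree. -/
def dup : Prog :=
  .seq (.push .b .slash) (.seq (.push .d .slash)
    (.seq (readTree true true) (.seq (back .b) (back .d))))

/-- Push a word. -/
def pushWord : List Symbol → Prog
  | [] => nop
  | s :: l => .seq (pushWord l) (.push .a s)

end Prog

open Prog

/-- Push the reverse of a word if the flag is set. -/
def revIf (g : Bool) (l B : List Symbol) : List Symbol := if g then l.reverse ++ B else B

theorem exec_nop (S : Store) : Exec nop S S 1 := .loop_done rfl

theorem store_ext {S : Store} {A B C D : List Symbol} (ha : S .a = A) (hb : S .b = B)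
    (hc : S .c = C) (hd : S .d = D) : S = store A B C D := by
  funext k
  cases k <;> assumption

section

variable (A B C D : List Symbol)

theorem exec_push_a (s) : Exec (.push .a s) (store A B C D) (store (s :: A) B C D) 1 :=
  (Exec.push _ _ _).congr (store_ext rfl rfl rfl rfl) rfl

theorem exec_push_b (s) : Exec (.push .b s) (store A B C D) (store A (s :: B) C D) 1 :=
  (Exec.push _ _ _).congr (store_ext rfl rfl rfl rfl) rfl

theorem exec_push_c (s) : Exec (.push .c s) (store A B C D) (store A B (s :: C) D) 1 :=
  (Exec.push _ _ _).congr (store_ext rfl rfl rfl rfl) rfl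

theorem exec_push_d (s) : Exec (.push .d s) (store A B C D) (store A B C (s :: D)) 1 :=
  (Exec.push _ _ _).congr (store_ext rfl rfl rfl rfl) rfl

theorem exec_drop_a (s) : Exec (drop .a) (store (s :: A) B C D) (store A B C D) 1 :=
  (Exec.move _ _ _ s A rfl).congr (store_ext rfl rfl rfl rfl) rfl

theorem exec_drop_b (s) : Exec (drop .b) (store A (s :: B) C D) (store A B C D) 1 :=
  (Exec.move _ _ _ s B rfl).congr (store_ext rfl rfl rfl rfl) rfl

theorem exec_drop_c (s) : Exec (drop .c) (store A B (s :: C) D) (store A B C D) 1 :=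
  (Exec.move _ _ _ s C rfl).congr (store_ext rfl rfl rfl rfl) rfl

theorem exec_drop_d (s) : Exec (drop .d) (store A B C (s :: D)) (store A B C D) 1 :=
  (Exec.move _ _ _ s D rfl).congr (store_ext rfl rfl rfl rfl) rfl

theorem exec_move_targets (gb gd s) : Exec (.move .a (targets gb gd)) (store (s :: A) B C D)
    (store A (revIf gb [s] B) C (revIf gd [s] D)) 1 :=
  (Exec.move _ _ _ s A rfl).congr (by
    apply store_ext <;> cases gb <;> cases gd <;> rfl) rfl

end

theorem revIf_append (g : Bool) (l l' B : List Symbol) :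
    revIf g (l ++ l') B = revIf g l' (revIf g l B) := by
  cases g <;> simp [revIf]

/-- The third stack counts in unary the trees still to be read: a `cons` bit replaces one tree by
two, a `nil` bit finishes one. The continuation `S`, `t` is arbitrary so that the two subtrees of a
`cons` can be read one after the other. Each symbol costs four steps: loop test, branch, counter
update, move. -/
theorem exec_readLoop (gb gd : Bool) (x : BTree) : ∀ (A B C D : List Symbol) (S : Store) (t : ℕ),
    Exec (readLoop gb gd) (store A (revIf gb x.code B) C (revIf gd x.code D)) S t →
    Exec (readLoop gb gd) (store (x.code ++ A) B (.vertex :: C) D) S (t + 4 * x.code.length) := by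
  induction x with
  | nil =>
    intro A B C D S t h
    refine (Exec.loop_next (by rfl)
      (Exec.branch (Exec.seq (t := 1) ?_ (exec_move_targets _ _ _ _ _ _ _))) h).congr rfl ?_
    · simp only [store, BTree.code, List.cons_append, List.head?_cons, Option.some.injEq,
        Symbol.bit.injEq, Bool.false_eq_true, if_false]
      exact exec_drop_c _ _ _ _ _
    · simp [BTree.code]; omega
  | cons x y ihx ihy =>
    intro A B C D S t h
    rw [BTree.code, ← List.singleton_append, revIf_append, revIf_append, revIf_append,
      revIf_append] at h
    have h' := ihx _ _ _ _ _ _ (ihy _ _ _ _ _ _ h)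
    rw [← List.append_assoc] at h'
    refine (Exec.loop_next (by rfl)
      (Exec.branch (Exec.seq (t := 1) ?_ (exec_move_targets _ _ _ _ _ _ _))) h').congr rfl ?_
    · simp only [store, BTree.code, List.cons_append, List.head?_cons, if_true]
      exact exec_push_c _ _ _ _ _
    · simp [BTree.code]; omega

theorem exec_readTree (gb gd : Bool) (x : BTree) (A B C D : List Symbol) :
    Exec (readTree gb gd) (store (x.code ++ A) B C D)
      (store A (revIf gb x.code B) C (revIf gd x.code D)) (4 * x.code.length + 4) := by
  refine ((exec_push_c _ _ _ _ _).seq ((exec_push_c _ _ _ _ _).seq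
    ((exec_readLoop gb gd x A B _ D _ 1 (.loop_done rfl)).seq (exec_drop_c _ _ _ _ _)))).congr
    rfl (by omega)

theorem exec_back_b (l A B C D : List Symbol) (hl : Symbol.slash ∉ l) :
    Exec (back .b) (store A (l.reverse ++ .slash :: B) C D) (store (l ++ A) B C D)
      (2 * l.length + 2) := by
  have key : ∀ (l A : List Symbol), Symbol.slash ∉ l →
      Exec (.loop .b (fun o => o ≠ some .slash) (.move .b (fun j => j = .a)))
        (store A (l ++ .slash :: B) C D) (store (l.reverse ++ A) (.slash :: B) C D)
        (2 * l.length + 1) := by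
    intro l
    induction l with
    | nil => intro A _; exact .loop_done (by simp [store])
    | cons s l ih =>
      intro A h
      simp only [List.mem_cons, not_or] at h
      refine (Exec.loop_next (by simpa [store] using Ne.symm h.1) ((Exec.move _ _ _ s _ rfl).congr
        (store_ext (by rfl) (by rfl) (by rfl) (by rfl)) rfl) (ih _ h.2)).congr ?_ ?_
      · simp [store]
      · simp; omega
  refine ((key l.reverse A (by simpa using hl)).seq (exec_drop_b _ _ _ _ _)).congr ?_ ?_ <;> simp

theorem exec_back_d (l A B C D : List Symbol) (hl : Symbol.slash ∉ l) :
    Exec (back .d) (store A B C (l.reverse ++ .slash :: D)) (store (l ++ A) B C D)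
      (2 * l.length + 2) := by
  have key : ∀ (l A : List Symbol), Symbol.slash ∉ l →
      Exec (.loop .d (fun o => o ≠ some .slash) (.move .d (fun j => j = .a)))
        (store A B C (l ++ .slash :: D)) (store (l.reverse ++ A) B C (.slash :: D))
        (2 * l.length + 1) := by
    intro l
    induction l with
    | nil => intro A _; exact .loop_done (by simp [store])
    | cons s l ih =>
      intro A h
      simp only [List.mem_cons, not_or] at h
      refine (Exec.loop_next (by simpa [store] using Ne.symm h.1) ((Exec.move _ _ _ s _ rfl).congr
        (store_ext (by rfl) (by rfl) (by rfl) (by rfl)) rfl) (ih _ h.2)).congr ?_ ?_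
      · simp [store]
      · simp; omega
  refine ((key l.reverse A (by simpa using hl)).seq (exec_drop_d _ _ _ _ _)).congr ?_ ?_ <;> simp

theorem exec_stash (x : BTree) (A B C D : List Symbol) :
    Exec stash (store (x.code ++ A) B C D) (store A (x.code.reverse ++ .slash :: B) C D)
      (4 * x.code.length + 5) :=
  ((exec_push_b _ _ _ _ _).seq (exec_readTree true false x A _ C D)).congr rfl (by omega)

theorem exec_unstash (x : BTree) (A B C D : List Symbol) :
    Exec (back .b) (store A (x.code.reverse ++ .slash :: B) C D) (store (x.code ++ A) B C D)
      (2 * x.code.length + 2) :=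
  exec_back_b _ _ _ _ _ x.slash_notMem_code

theorem exec_dropTree (x : BTree) (A B C D : List Symbol) :
    Exec (readTree false false) (store (x.code ++ A) B C D) (store A B C D)
      (4 * x.code.length + 4) :=
  exec_readTree false false x A B C D

theorem exec_dup (x : BTree) (A B C D : List Symbol) :
    Exec dup (store (x.code ++ A) B C D) (store (x.code ++ (x.code ++ A)) B C D)
      (8 * x.code.length + 10) :=
  ((exec_push_b _ _ _ _ _).seq ((exec_push_d _ _ _ _ _).seq
    ((exec_readTree true true x A _ C _).seq ((exec_unstash x _ _ _ _).seq
      (exec_back_d _ _ _ _ _ x.slash_notMem_code))))).congr rfl (by omega)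

theorem exec_pushWord (l A B C D : List Symbol) :
    Exec (pushWord l) (store A B C D) (store (l ++ A) B C D) (l.length + 1) := by
  induction l with
  | nil => exact exec_nop _
  | cons s l ih => exact (ih.seq (exec_push_a _ _ _ _ _)).congr rfl (by simp)

/-! ### Tree encodings of data, polynomial bounds and the closure properties of `PolyTime`. -/

/-- Types whose elements are represented by trees. -/
class Enc (α : Type) where
  /-- the tree which represents an element -/
  enc : α → BTree

export Enc (enc)

/-- The length of the notation of an element. -/
def size {α : Type} [Enc α] (x : α) : ℕ := (enc x).code.length

instance : Enc BTree := ⟨id⟩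

/-- `false`, the empty list, `none` and `0` are all represented by `nil`, so a single test for `nil`
serves every case distinction. -/
instance : Enc Bool := ⟨fun b => cond b (.cons .nil .nil) .nil⟩

instance {α β : Type} [Enc α] [Enc β] : Enc (α × β) := ⟨fun x => .cons (enc x.1) (enc x.2)⟩

/-- The tree of a list. -/
def encList {α : Type} [Enc α] : List α → BTree
  | [] => .nil
  | x :: l => .cons (enc x) (encList l)

instance {α : Type} [Enc α] : Enc (List α) := ⟨encList⟩

instance {α : Type} [Enc α] : Enc (Option α) := ⟨fun o => encList o.toList⟩

instance : Enc ℕ := ⟨fun n => enc n.bits⟩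

variable {α β γ δ : Type} [Enc α] [Enc β] [Enc γ] [Enc δ]

@[simp] theorem enc_pair (x : α × β) : enc x = .cons (enc x.1) (enc x.2) := rfl
@[simp] theorem enc_listNil : enc ([] : List α) = .nil := rfl
@[simp] theorem enc_listCons (x : α) (l : List α) : enc (x :: l) = .cons (enc x) (enc l) := rfl

theorem size_pos (x : α) : 0 < size x := BTree.code_length_pos _

@[simp] theorem size_pair (x : α × β) : size x = size x.1 + size x.2 + 1 := by
  simp [size, BTree.code]

@[simp] theorem size_listNil : size ([] : List α) = 1 := rfl

@[simp] theorem size_listCons (x : α) (l : List α) : size (x :: l) = size x + size l + 1 := by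
  simp [size, BTree.code]

theorem length_lt_size (l : List α) : l.length < size l := by
  induction l with
  | nil => simp
  | cons x l ih => simp; omega

theorem size_le_of_mem {x : α} {l : List α} (h : x ∈ l) : size x ≤ size l := by
  induction l with
  | nil => simp at h
  | cons y l ih =>
    rcases List.mem_cons.1 h with rfl | h
    · simp; omega
    · have := ih h; simp; omega

theorem size_append (l l' : List α) : size (l ++ l') + 1 = size l + size l' := by
  induction l with
  | nil => simp; omega
  | cons x l ih => simp; omega

/-- A bound which is polynomial in the size. -/
def PolyBound (T : α → ℕ) : Prop := ∃ P : Polynomial ℕ, ∀ x, T x ≤ P.eval (size x)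

/-- Natural coefficients make the bounds monotone, which is what allows them to be composed. -/
theorem _root_.Polynomial.eval_nat_mono (P : Polynomial ℕ) : Monotone fun n => P.eval n := by
  intro m n h
  simp only [Polynomial.eval_eq_sum_range]
  gcongr

namespace PolyBound

theorem mono {T T' : α → ℕ} (h : PolyBound T') (hT : ∀ x, T x ≤ T' x) : PolyBound T :=
  h.imp fun _ hP x => (hT x).trans (hP x)

theorem const (c : ℕ) : PolyBound fun _ : α => c := ⟨.C c, fun _ => by simp⟩

theorem size : PolyBound (size : α → ℕ) := ⟨.X, fun _ => by simp⟩

theorem add {T T' : α → ℕ} (h : PolyBound T) (h' : PolyBound T') :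
    PolyBound fun x => T x + T' x := by
  obtain ⟨P, hP⟩ := h
  obtain ⟨Q, hQ⟩ := h'
  exact ⟨P + Q, fun x => by simpa using add_le_add (hP x) (hQ x)⟩

theorem mul {T T' : α → ℕ} (h : PolyBound T) (h' : PolyBound T') :
    PolyBound fun x => T x * T' x := by
  obtain ⟨P, hP⟩ := h
  obtain ⟨Q, hQ⟩ := h'
  exact ⟨P * Q, fun x => by simpa using mul_le_mul' (hP x) (hQ x)⟩

theorem comp_of_size {T : β → ℕ} (h : PolyBound T) {f : α → β}
    (hf : PolyBound fun x => StackProg.size (f x)) : PolyBound fun x => T (f x) := by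
  obtain ⟨P, hP⟩ := h
  obtain ⟨Q, hQ⟩ := hf
  exact ⟨P.comp Q, fun x => by
    simpa using (hP _).trans (P.eval_nat_mono (hQ x))⟩

end PolyBound

/-- `f` can be computed by a program in polynomial time. -/
@[fun_prop]
def PolyTime (f : α → β) : Prop :=
  -- The contents underneath must survive, so that a program can run as part of another one while
  -- further data are kept below.
  ∃ p : Prog, ∃ T : α → ℕ, PolyBound T ∧ ∀ x A B C D, ∃ t ≤ T x,
    Exec p (store ((enc x).code ++ A) B C D) (store ((enc (f x)).code ++ A) B C D) t

namespace PolyTime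

theorem size_bound {f : α → β} (hf : PolyTime f) : PolyBound fun x => size (f x) := by
  obtain ⟨p, T, hT, h⟩ := hf
  refine (PolyBound.size.add hT).mono fun x => ?_
  obtain ⟨t, ht, hx⟩ := h x [] [] [] []
  have := hx.length_le .a
  simp only [store, List.append_nil] at this
  unfold size
  omega

theorem bound_comp {T : β → ℕ} (h : PolyBound T) {f : α → β} (hf : PolyTime f) :
    PolyBound fun x => T (f x) := h.comp_of_size hf.size_bound

/-- A function which changes the type only. -/
theorem of_enc_eq {f : α → β} (h : ∀ x, enc (f x) = enc x) : PolyTime f :=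
  ⟨nop, _, .const 1, fun x A B C D => ⟨1, le_rfl, by rw [h]; exact exec_nop _⟩⟩

/-- Computability depends on the representation of the results only. -/
theorem congr_enc {f : α → β} {g : α → γ} (hg : PolyTime g) (h : ∀ x, enc (f x) = enc (g x)) :
    PolyTime f := by
  obtain ⟨p, T, hT, hp⟩ := hg
  exact ⟨p, T, hT, fun x A B C D => by rw [h]; exact hp x A B C D⟩

@[fun_prop]
theorem id : PolyTime fun x : α => x := of_enc_eq fun _ => rfl

@[fun_prop]
theorem const (b : β) : PolyTime fun _ : α => b :=
  ⟨.seq (readTree false false) (pushWord (enc b).code), fun x => 4 * size x + 4 + (size b + 1),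
    (((PolyBound.const 4).mul .size).add (.const 4)).add (.const _),
    fun x A B C D => ⟨_, le_rfl, (exec_dropTree (enc x) A B C D).seq (exec_pushWord _ _ _ _ _)⟩⟩

@[fun_prop]
theorem comp {g : β → γ} {f : α → β} (hg : PolyTime g) (hf : PolyTime f) :
    PolyTime fun x => g (f x) := by
  have hb := hf
  obtain ⟨p, T, hT, h⟩ := hf
  obtain ⟨p', T', hT', h'⟩ := hg
  refine ⟨.seq p p', _, hT.add (bound_comp hT' hb), fun x A B C D => ?_⟩
  obtain ⟨t, ht, hx⟩ := h x A B C D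
  obtain ⟨t', ht', hx'⟩ := h' (f x) A B C D
  exact ⟨_, add_le_add ht ht', hx.seq hx'⟩

@[fun_prop]
theorem prodMk {f : α → β} {g : α → γ} (hf : PolyTime f) (hg : PolyTime g) :
    PolyTime fun x => (f x, g x) := by
  have hb := hf.size_bound
  obtain ⟨p, T, hT, h⟩ := hf
  obtain ⟨p', T', hT', h'⟩ := hg
  -- `f` consumes the upper copy of the input; its result waits on the second stack while `g`
  -- consumes the lower copy. The final `bit true` is the constructor of the pair.
  refine ⟨.seq dup (.seq p (.seq stash (.seq p' (.seq (back .b) (.push .a (.bit true)))))),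
    fun x => 8 * size x + 10 + T x + (4 * size (f x) + 5) + T' x + (2 * size (f x) + 2) + 1,
    ?_, fun x A B C D => ?_⟩
  · have c := fun n => PolyBound.const (α := α) n
    exact ((((((((c 8).mul .size).add (c 10)).add hT).add
      (((c 4).mul hb).add (c 5))).add hT').add (((c 2).mul hb).add (c 2))).add (c 1))
  · obtain ⟨t, ht, hx⟩ := h x ((enc x).code ++ A) B C D
    obtain ⟨t', ht', hx'⟩ := h' x A ((enc (f x)).code.reverse ++ .slash :: B) C D
    refine ⟨_, ?_, ((exec_dup _ A B C D).seq (hx.seq ((exec_stash _ _ _ _ _).seq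
      (hx'.seq ((exec_unstash _ _ _ _ _).seq (exec_push_a _ _ _ _ _)))))).congr ?_ rfl⟩
    · simp only [size]
      omega
    · simp [BTree.code]

@[fun_prop]
theorem fst {f : α → β × γ} (hf : PolyTime f) : PolyTime fun x => (f x).1 := by
  refine comp (g := Prod.fst) ⟨.seq (drop .a) (.seq stash (.seq (readTree false false) (back .b))),
    fun x => 12 * size x + 20, ((PolyBound.const 12).mul .size).add (.const 20),
    fun x A B C D => ?_⟩ hf
  refine ⟨_, ?_, (exec_drop_a _ _ _ _ _).seq (Exec.seq (t := 4 * size x.1 + 5) ?_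
    ((exec_dropTree (enc x.2) _ _ _ _).seq (exec_unstash (enc x.1) _ _ _ _)))⟩
  · simp [size, BTree.code]; omega
  · exact (exec_stash _ _ _ _ _).congr' (by simp)

@[fun_prop]
theorem snd {f : α → β × γ} (hf : PolyTime f) : PolyTime fun x => (f x).2 := by
  refine comp (g := Prod.snd) ⟨.seq (drop .a) (readTree false false),
    fun x => 12 * size x + 20, ((PolyBound.const 12).mul .size).add (.const 20),
    fun x A B C D => ?_⟩ hf
  refine ⟨_, ?_, (exec_drop_a _ _ _ _ _).seq (t' := 4 * size x.1 + 4) ?_⟩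
  · simp [size, BTree.code]; omega
  · exact (exec_dropTree _ _ _ _ _).congr' (by simp)

/-- A bounded iteration over a list. -/
theorem foldl {l : α → List β} {init : α → γ} {step : α → γ → β → γ} (hl : PolyTime l)
    (hi : PolyTime init) (hs : PolyTime fun p : α × γ × β => step p.1 p.2.1 p.2.2)
    {b : α → ℕ} (hb : PolyBound b)
    (hsize : ∀ x l₁, l₁ <+: l x → size (l₁.foldl (step x) (init x)) ≤ b x) :
    PolyTime fun x => (l x).foldl (step x) (init x) := by
  -- The state of the loop is the pair of the remaining list and `(x, s)`, with `s` the value so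
  -- far. A nonempty remaining list is written like the pair of its head and tail, so no work is
  -- needed to split it.
  have hbody : PolyTime fun q : (β × List β) × (α × γ) =>
      (q.1.2, (q.2.1, step q.2.1 q.2.2 q.1.1)) := by
    have : PolyTime fun q : (β × List β) × (α × γ) =>
      (fun p : α × γ × β => step p.1 p.2.1 p.2.2) (q.2.1, q.2.2, q.1.1) := comp hs (by fun_prop)
    fun_prop
  have hpre : PolyTime fun x => (l x, (x, init x)) := by fun_prop
  have hlen := hl.size_bound
  obtain ⟨p, T, ⟨P, hP⟩, h⟩ := hbody
  obtain ⟨p', T', hT', h'⟩ := hpre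
  -- The bound on all partial results bounds the cost of every round uniformly. Without it, a
  -- polynomial step could be iterated to exponential size.
  have hW : PolyBound fun x => P.eval (size (l x) + (size x + b x + 1) + 1) := by
    have : PolyBound fun x => size (l x) + (size x + b x + 1) + 1 :=
      (hlen.add ((PolyBound.size.add hb).add (.const 1))).add (.const 1)
    obtain ⟨Q, hQ⟩ := this
    exact ⟨P.comp Q, fun x => by simpa using P.eval_nat_mono (hQ x)⟩
  have hr : PolyTime fun x : α => (([] : List β), (x, (l x).foldl (step x) (init x))) := by
    refine ⟨.seq p' (.seq (drop .a) (.seq (.loop .a (fun o => o = some (.bit true))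
      (.seq (.push .a (.bit true)) (.seq p (drop .a)))) (.push .a (.bit true)))),
      fun x => T' x + (size (l x) * (P.eval (size (l x) + (size x + b x + 1) + 1) + 3) + 3),
      hT'.add ((hlen.mul (hW.add (.const 3))).add (.const 3)), fun x A B C D => ?_⟩
    -- Between rounds the `cons` bit of the outer pair is left off, so that the loop test sees the
    -- first bit of the remaining list; each round puts the bit back for `p` and drops it
    -- afterwards. These two steps and the test are the `+ 3`.
    have key : ∀ l₂ l₁, l₁ ++ l₂ = l x → ∃ t ≤ l₂.length *
        (P.eval (size (l x) + (size x + b x + 1) + 1) + 3) + 1,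
        Exec (.loop .a (fun o => o = some (.bit true))
          (.seq (.push .a (.bit true)) (.seq p (drop .a))))
          (store ((enc l₂).code ++ ((enc (x, l₁.foldl (step x) (init x))).code ++ A)) B C D)
          (store ((enc ([] : List β)).code ++
            ((enc (x, (l x).foldl (step x) (init x))).code ++ A)) B C D) t := by
      intro l₂
      induction l₂ with
      | nil =>
        intro l₁ hl₁
        rw [List.append_nil] at hl₁
        subst hl₁
        exact ⟨1, by omega, .loop_done rfl⟩
      | cons y l₂ ih =>
        intro l₁ hl₁
        obtain ⟨t, ht, hx⟩ := ih (l₁ ++ [y]) (by simpa using hl₁)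
        rw [List.foldl_append] at hx
        obtain ⟨u, hu, hy⟩ := h ((y, l₂), (x, l₁.foldl (step x) (init x))) A B C D
        have hsz : u ≤ P.eval (size (l x) + (size x + b x + 1) + 1) := by
          refine hu.trans ((hP _).trans (P.eval_nat_mono ?_))
          have h1 := hsize x l₁ ⟨_, hl₁⟩
          have h2 := size_append l₁ (y :: l₂)
          rw [hl₁] at h2
          have h3 := size_pos l₁
          simp at h2 ⊢
          omega
        refine ⟨_, ?_, Exec.loop_next rfl ((exec_push_a _ _ _ _ _).seq ((hy.congr' ?_).seq
          (exec_drop_a _ _ _ _ _))) (hx.congr' ?_)⟩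
        · simp only [List.length_cons, Nat.add_mul]
          omega
        · simp [BTree.code]
        · simp [BTree.code]
    obtain ⟨t, ht, hx⟩ := key (l x) [] rfl
    obtain ⟨t', ht', hx'⟩ := h' x A B C D
    refine ⟨_, ?_, hx'.seq ((exec_drop_a _ _ _ _ _).seq ((hx.congr' ?_).seq
      ((exec_push_a _ _ _ _ _).congr ?_ rfl)))⟩
    · have := Nat.mul_le_mul_right (P.eval (size (l x) + (size x + b x + 1) + 1) + 3)
        (length_lt_size (l x)).le
      dsimp only
      omega
    · simp
    · simp [BTree.code]
  exact snd (snd hr)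

end PolyTime

end StackProg

/-! ### A library of polynomial time functions -/

namespace StackProg

open MatchingGame (Symbol)

variable {α β γ δ : Type} [Enc α] [Enc β] [Enc γ] [Enc δ]

/-- Elements of a subtype are written like the underlying elements, so a branch of a case
distinction can be computed under the hypothesis of its case. -/
instance {p : α → Prop} : Enc {x // p x} := ⟨fun x => enc x.1⟩

namespace PolyTime

@[fun_prop]
theorem val {p : β → Prop} {f : α → {x // p x}} (hf : PolyTime f) : PolyTime fun x => (f x).1 :=
  comp (g := Subtype.val) (of_enc_eq fun _ => rfl) hf

theorem subtype_mk {p : β → Prop} {f : α → β} (hf : PolyTime f) (h : ∀ x, p (f x)) :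
    PolyTime fun x => (⟨f x, h x⟩ : {x // p x}) :=
  comp (g := fun y : {y // ∃ x, f x = y} => (⟨y.1, by obtain ⟨x, hx⟩ := y.2; exact hx ▸ h x⟩ :
    {x // p x})) (f := fun x => ⟨f x, x, rfl⟩) (of_enc_eq fun _ => rfl) hf

/-- Case distinction on whether a tree is `nil`, by functions which need only be computed in
their own case. -/
theorem tree_cases' {f : α → β} {g : α → β} {c : α → BTree} (hc : PolyTime c)
    (hf : PolyTime fun x : {x // c x = .nil} => f x.1)
    (hg : PolyTime fun x : {x // c x ≠ .nil} => g x.1) :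
    PolyTime fun x => if c x = .nil then f x else g x := by
  have hp := prodMk hc id
  have hcb := hc.size_bound
  obtain ⟨p, T, hT, h⟩ := hp
  obtain ⟨pf, Tf, ⟨Pf, hPf⟩, hf⟩ := hf
  obtain ⟨pg, Tg, ⟨Pg, hPg⟩, hg⟩ := hg
  -- Once the leading bit of the pair `(c x, x)` is gone, the top bit is `false` exactly when `c x`
  -- is `nil`. The tree `c x` is then discarded in front of the saved `x`.
  refine ⟨.seq p (.seq (.drop .a) (.branch .a fun o =>
      if o = some (.bit false) then .seq (.readTree false false) pf
      else .seq (.readTree false false) pg)),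
    fun x => T x + (4 * size (c x) + 6) + Pf.eval (size x) + Pg.eval (size x), ?_,
    fun x A B C D => ?_⟩
  · exact ((hT.add (((PolyBound.const 4).mul hcb).add (.const 6))).add
      ⟨Pf, fun _ => le_rfl⟩).add ⟨Pg, fun _ => le_rfl⟩
  obtain ⟨t, ht, hx⟩ := h x A B C D
  have hd := exec_dropTree (c x) ((enc x).code ++ A) B C D
  rw [← List.append_assoc] at hd
  cases hcx : c x with
  | nil =>
    obtain ⟨t', ht', hx'⟩ := hf ⟨x, hcx⟩ A B C D
    have ht' : t' ≤ Pf.eval (size x) := ht'.trans (hPf _)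
    refine ⟨_, ?_, hx.seq ((exec_drop_a _ _ _ _ _).seq (Exec.branch
      (t := 4 * size (c x) + 4 + t') ?_))⟩
    · dsimp only; omega
    · simp only [store, enc, hcx, id_eq, BTree.code, List.cons_append]
      rw [hcx] at hd
      exact hd.seq hx'
  | cons y z =>
    obtain ⟨t', ht', hx'⟩ := hg ⟨x, by simp [hcx]⟩ A B C D
    have ht' : t' ≤ Pg.eval (size x) := ht'.trans (hPg _)
    refine ⟨_, ?_, hx.seq ((exec_drop_a _ _ _ _ _).seq (Exec.branch
      (t := 4 * size (c x) + 4 + t') ?_))⟩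
    · dsimp only; omega
    · simp only [store, enc, hcx, id_eq, BTree.code, List.cons_append]
      rw [hcx] at hd
      exact hd.seq hx'

/-- Case distinction on whether a tree is `nil`. -/
theorem tree_cases {f : α → β} {g : α → β} {c : α → BTree} (hc : PolyTime c) (hf : PolyTime f)
    (hg : PolyTime g) : PolyTime fun x => if c x = .nil then f x else g x :=
  tree_cases' hc (comp hf (by fun_prop)) (comp hg (by fun_prop))

theorem toTree {f : α → β} (hf : PolyTime f) : PolyTime fun x => (enc (f x) : BTree) :=
  comp (g := fun y : β => enc y) (of_enc_eq fun _ => rfl) hf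

@[fun_prop]
theorem bcond {c : α → Bool} {f g : α → β} (hc : PolyTime c) (hf : PolyTime f)
    (hg : PolyTime g) : PolyTime fun x => cond (c x) (f x) (g x) := by
  convert! tree_cases hc.toTree hg hf using 2 with x
  cases c x <;> simp [enc]

@[fun_prop]
theorem ite {p : α → Prop} [DecidablePred p] {f g : α → β}
    (hp : PolyTime fun x => decide (p x)) (hf : PolyTime f) (hg : PolyTime g) :
    PolyTime fun x => if p x then f x else g x := by
  convert! bcond hp hf hg using 2 with x
  by_cases h : p x <;> simp [h]

theorem of_bool (f : Bool → β) : PolyTime f := by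
  convert! bcond id (const (f true)) (const (f false)) using 2 with b
  cases b <;> rfl

theorem of_bool₂ (f : Bool → Bool → β) : PolyTime fun p : Bool × Bool => f p.1 p.2 := by
  have : PolyTime fun p : Bool × Bool => cond p.1 (f true p.2) (f false p.2) :=
    bcond (by fun_prop) (comp (of_bool (f true)) (by fun_prop))
      (comp (of_bool (f false)) (by fun_prop))
  convert! this using 2 with p
  cases p.1 <;> rfl

theorem of_bool₃ (f : Bool → Bool → Bool → β) :
    PolyTime fun p : Bool × Bool × Bool => f p.1 p.2.1 p.2.2 := by
  have : PolyTime fun p : Bool × Bool × Bool =>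
      cond p.1 (f true p.2.1 p.2.2) (f false p.2.1 p.2.2) :=
    bcond (by fun_prop) (comp (of_bool₂ (f true)) (by fun_prop))
      (comp (of_bool₂ (f false)) (by fun_prop))
  convert! this using 2 with p
  cases p.1 <;> rfl

@[fun_prop]
theorem not {c : α → Bool} (hc : PolyTime c) : PolyTime fun x => !c x :=
  comp (of_bool _) hc

@[fun_prop]
theorem and {c d : α → Bool} (hc : PolyTime c) (hd : PolyTime d) : PolyTime fun x => c x && d x :=
  comp (of_bool₂ Bool.and) (prodMk hc hd)

@[fun_prop]
theorem or {c d : α → Bool} (hc : PolyTime c) (hd : PolyTime d) : PolyTime fun x => c x || d x :=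
  comp (of_bool₂ Bool.or) (prodMk hc hd)

@[fun_prop]
theorem cons {f : α → β} {l : α → List β} (hf : PolyTime f) (hl : PolyTime l) :
    PolyTime fun x => f x :: l x :=
  comp (g := fun p : β × List β => p.1 :: p.2) (of_enc_eq fun _ => rfl) (prodMk hf hl)

@[fun_prop]
theorem isEmpty {l : α → List β} (hl : PolyTime l) : PolyTime fun x => (l x).isEmpty := by
  convert! tree_cases hl.toTree (const true) (const false) using 2 with x
  cases l x <;> simp

/-- Case distinction on a list. -/
theorem list_cases {l : α → List β} {f : α → γ} {g : α → β → List β → γ} (hl : PolyTime l)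
    (hf : PolyTime f) (hg : PolyTime fun p : α × β × List β => g p.1 p.2.1 p.2.2) :
    PolyTime fun x => match l x with
      | [] => f x
      | y :: t => g x y t := by
  have : PolyTime fun x => if enc (l x) = .nil then f x else
    if h : l x = [] then f x else g x ((l x).head h) (l x).tail := by
    refine tree_cases' hl.toTree (by fun_prop) ?_
    have hne : ∀ x : {x // enc (l x) ≠ .nil}, l x.1 ≠ [] := fun x h => x.2 (by rw [h]; rfl)
    -- A nonempty list and the pair of its head and tail are the same tree, so taking it apart costs
    -- nothing.
    have h1 : PolyTime fun x : {x // enc (l x) ≠ .nil} =>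
        (x.1, (l x.1).head (hne x), (l x.1).tail) := by
      refine prodMk (by fun_prop) (comp (g := fun y : {y : List β // y ≠ []} =>
        (y.1.head y.2, y.1.tail)) (of_enc_eq ?_) (subtype_mk (f := fun x : {x // enc (l x) ≠ .nil} => l x.1) ?_ hne))
      · rintro ⟨_ | ⟨y, t⟩, h⟩
        · exact absurd rfl h
        · rfl
      · fun_prop
    convert! comp hg h1 using 2 with x
    simp [hne x]
  convert! this using 2 with x
  cases l x <;> simp

@[fun_prop]
theorem head? {l : α → List β} (hl : PolyTime l) : PolyTime fun x => (l x).head? := by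
  have : PolyTime fun l : List β => (match l with
      | [] => []
      | y :: _ => [y] : List β) :=
    list_cases id (const []) (by fun_prop)
  exact comp (g := fun l : List β => l.head?) (this.congr_enc fun x => by cases x <;> rfl) hl

@[fun_prop]
theorem some {f : α → β} (hf : PolyTime f) : PolyTime fun x => Option.some (f x) :=
  (cons hf (const [])).head?

@[fun_prop]
theorem tail {l : α → List β} (hl : PolyTime l) : PolyTime fun x => (l x).tail := by
  have : PolyTime fun x => match l x with
      | [] => []
      | _ :: t => t :=
    list_cases hl (const []) (by fun_prop)
  convert! this using 2 with x

/-- Case distinction on an option. -/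
theorem elim {o : α → Option β} {f : α → γ} {g : α → β → γ} (ho : PolyTime o)
    (hf : PolyTime f) (hg : PolyTime fun p : α × β => g p.1 p.2) :
    PolyTime fun x => (o x).elim (f x) (g x) := by
  have h1 : PolyTime fun x => (o x).toList :=
    comp (g := fun o : Option β => o.toList) (of_enc_eq fun _ => rfl) ho
  have : PolyTime fun x => match (o x).toList with
      | [] => f x
      | y :: _ => g x y :=
    list_cases h1 hf (comp (f := fun p : α × β × List β => (p.1, p.2.1)) hg (by fun_prop))
  convert! this using 2 with x
  cases o x <;> rfl

/-- On elements of a computed list, the results of a function have bounded size. -/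
theorem exists_bound {l : α → List β} {f : α → β → γ} (hl : PolyTime l)
    (hf : PolyTime fun p : α × β => f p.1 p.2) :
    ∃ b : α → ℕ, PolyBound b ∧ ∀ x, ∀ y ∈ l x, size (f x y) ≤ b x := by
  obtain ⟨P, hP⟩ := hf.size_bound
  have : PolyBound fun x => size x + size (l x) + 1 :=
    (PolyBound.size.add hl.size_bound).add (.const 1)
  obtain ⟨Q, hQ⟩ := this
  refine ⟨fun x => P.eval (Q.eval (size x)), ⟨P.comp Q, fun x => by simp⟩, fun x y hy => ?_⟩
  refine (hP (x, y)).trans (P.eval_nat_mono (le_trans ?_ (hQ x)))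
  have := size_le_of_mem hy
  simp only [size_pair]
  omega

/-- Iteration over a list, where every step adds a bounded amount to the size. -/
theorem foldl_of_growth {l : α → List β} {init : α → γ} {step : α → γ → β → γ}
    (hl : PolyTime l) (hi : PolyTime init)
    (hs : PolyTime fun p : α × γ × β => step p.1 p.2.1 p.2.2)
    {b : α → ℕ} (hb : PolyBound b)
    (hsize : ∀ x s, ∀ y ∈ l x, size (step x s y) ≤ size s + b x) :
    PolyTime fun x => (l x).foldl (step x) (init x) := by
  refine foldl hl hi hs (b := fun x => size (init x) + size (l x) * b x)
    (hi.size_bound.add (hl.size_bound.mul hb)) fun x l₁ hl₁ => ?_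
  have key : ∀ (l₁ : List β) (s : γ), (∀ y ∈ l₁, y ∈ l x) →
      size (l₁.foldl (step x) s) ≤ size s + l₁.length * b x := by
    intro l₁
    induction l₁ with
    | nil => simp
    | cons y l₁ ih =>
      intro s h
      have h1 := ih (step x s y) fun z hz => h z (by simp [hz])
      have h2 := hsize x s y (h y (by simp))
      simp only [List.foldl_cons, List.length_cons, Nat.add_mul]
      omega
  refine (key l₁ _ fun y hy => hl₁.subset hy).trans ?_
  have := hl₁.length_le.trans (length_lt_size _).le
  gcongr

@[fun_prop]
theorem reverse {l : α → List β} (hl : PolyTime l) : PolyTime fun x => (l x).reverse := by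
  have : PolyTime fun x => (l x).foldl (fun s y => y :: s) [] :=
    foldl_of_growth hl (const []) (step := fun _ s y => y :: s) (by fun_prop)
      (hl.size_bound.add (.const 1)) fun x s y hy => by
        have := size_le_of_mem hy
        simp only [size_listCons]
        omega
  simpa using this

theorem foldr_cons {l : α → List β} {init : α → List γ} {f : α → β → List γ → List γ}
    (hl : PolyTime l) (hi : PolyTime init)
    (hf : PolyTime fun p : α × List γ × β => f p.1 p.2.2 p.2.1)
    {b : α → ℕ} (hb : PolyBound b)
    (hsize : ∀ x s, ∀ y ∈ l x, size (f x y s) ≤ size s + b x) :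
    PolyTime fun x => (l x).foldr (f x) (init x) := by
  have : PolyTime fun x => (l x).reverse.foldl (fun s y => f x y s) (init x) :=
    foldl_of_growth hl.reverse hi (step := fun x s y => f x y s) hf hb
      fun x s y hy => hsize x s y (by simpa using hy)
  simpa using this

@[fun_prop]
theorem append {l l' : α → List β} (hl : PolyTime l) (hl' : PolyTime l') :
    PolyTime fun x => l x ++ l' x := by
  have : PolyTime fun x => (l x).foldr (fun y s => y :: s) (l' x) :=
    foldr_cons hl hl' (f := fun _ y s => y :: s) (by fun_prop)
      (hl.size_bound.add (.const 1)) fun x s y hy => by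
        have := size_le_of_mem hy
        simp only [size_listCons]
        omega
  simpa using this

theorem flatMap {l : α → List β} {f : α → β → List γ} (hl : PolyTime l)
    (hf : PolyTime fun p : α × β => f p.1 p.2) : PolyTime fun x => (l x).flatMap (f x) := by
  obtain ⟨b, hb, h⟩ := exists_bound hl hf
  have : PolyTime fun x => (l x).foldr (fun y s => f x y ++ s) [] :=
    foldr_cons hl (const []) (f := fun x y s => f x y ++ s)
      (append (comp (f := fun p : α × List γ × β => (p.1, p.2.2)) hf (by fun_prop))
        (by fun_prop)) hb fun x s y hy => by
        have := h x y hy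
        have := size_append (f x y) s
        omega
  convert! this using 2 with x
  induction l x <;> simp_all

theorem map {l : α → List β} {f : α → β → γ} (hl : PolyTime l)
    (hf : PolyTime fun p : α × β => f p.1 p.2) : PolyTime fun x => (l x).map (f x) := by
  have : PolyTime fun x => (l x).flatMap (fun y => [f x y]) :=
    flatMap hl (f := fun x y => [f x y]) (by fun_prop)
  convert! this using 2 with x
  induction l x <;> simp_all

theorem filter {l : α → List β} {f : α → β → Bool} (hl : PolyTime l)
    (hf : PolyTime fun p : α × β => f p.1 p.2) : PolyTime fun x => (l x).filter (f x) := by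
  have : PolyTime fun x => (l x).flatMap (fun y => cond (f x y) [y] []) :=
    flatMap hl (f := fun x y => cond (f x y) [y] []) (by fun_prop)
  convert! this using 2 with x
  induction l x with
  | nil => rfl
  | cons y t ih => cases h : f x y <;> simp_all

theorem find? {l : α → List β} {f : α → β → Bool} (hl : PolyTime l)
    (hf : PolyTime fun p : α × β => f p.1 p.2) : PolyTime fun x => (l x).find? (f x) := by
  have := (filter hl hf).head?
  simpa using this

theorem any {l : α → List β} {f : α → β → Bool} (hl : PolyTime l)
    (hf : PolyTime fun p : α × β => f p.1 p.2) : PolyTime fun x => (l x).any (f x) := by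
  have := (filter hl hf).isEmpty.not
  convert! this using 2 with x
  induction l x with
  | nil => rfl
  | cons y t ih => cases h : f x y <;> simp_all

end PolyTime

end StackProg

/-! ### Arithmetic in polynomial time -/

namespace StackProg

open MatchingGame (Symbol)

variable {α β γ δ : Type} [Enc α] [Enc β] [Enc γ] [Enc δ]

theorem size_bool_le (b : Bool) : size b ≤ 3 := by cases b <;> decide

theorem size_bits (l : List Bool) : size l ≤ 4 * l.length + 1 := by
  induction l with
  | nil => simp
  | cons b l ih =>
    have := size_bool_le b
    simp only [size_listCons, List.length_cons]
    omega

theorem size_nat (n : ℕ) : size n = size n.bits := rfl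

theorem length_bits (n : ℕ) : n.bits.length = n.size := Nat.size_eq_bits_len n

theorem size_nat_le_of_lt {n k : ℕ} (h : n < 2 ^ k) : size n ≤ 4 * k + 1 := by
  have h1 := size_bits n.bits
  have h2 := Nat.size_le.2 h
  rw [length_bits] at h1
  rw [size_nat]
  omega

theorem lt_two_pow_size (n : ℕ) : n < 2 ^ size n := by
  have h1 := length_lt_size n.bits
  rw [length_bits] at h1
  exact Nat.size_le.1 h1.le

/-- The number with the given bits, most significant bit first. -/
def ofBits (l : List Bool) : ℕ := l.foldl (fun n b => Nat.bit b n) 0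

theorem foldl_bit (l : List Bool) (n : ℕ) :
    l.foldl (fun n b => Nat.bit b n) n = 2 ^ l.length * n + ofBits l := by
  induction l generalizing n with
  | nil => simp [ofBits]
  | cons b l ih =>
    rw [ofBits, List.foldl_cons, List.foldl_cons, ih, ih (Nat.bit b 0)]
    cases b <;> simp [Nat.bit, pow_succ] <;> ring

theorem ofBits_cons (b : Bool) (l : List Bool) :
    ofBits (b :: l) = 2 ^ l.length * b.toNat + ofBits l := by
  rw [ofBits, List.foldl_cons, foldl_bit]
  cases b <;> simp [Nat.bit]

theorem ofBits_lt (l : List Bool) : ofBits l < 2 ^ l.length := by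
  induction l with
  | nil => simp [ofBits]
  | cons b l ih =>
    rw [ofBits_cons, List.length_cons, pow_succ]
    cases b <;> simp <;> omega

theorem ofBits_bits_reverse (n : ℕ) : ofBits n.bits.reverse = n := by
  induction n using Nat.binaryRec' with
  | zero => simp [ofBits]
  | bit b n h ih =>
    rw [Nat.bits_append_bit _ _ h, List.reverse_cons, ofBits, List.foldl_append]
    change Nat.bit b (ofBits _) = _
    rw [ih]

theorem size_bit_le (b : Bool) (n : ℕ) : size (Nat.bit b n) ≤ size n + 4 := by
  by_cases h : n = 0 → b = true
  · have := size_bool_le b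
    rw [size_nat, Nat.bits_append_bit _ _ h, size_listCons, ← size_nat]
    omega
  · simp only [Classical.not_imp, Bool.not_eq_true] at h
    rw [h.1, h.2]
    decide

theorem size_div2_le (n : ℕ) : size n.div2 ≤ size n := by
  rw [size_nat, size_nat, Nat.div2_bits_eq_tail]
  cases n.bits with
  | nil => simp
  | cons b l => simp; omega

/-- One step of a serial computation on two numbers with a carry. -/
def serialStep (s k : Bool → Bool → Bool → Bool) (q : ℕ × ℕ × Bool × List Bool) :
    ℕ × ℕ × Bool × List Bool :=
  (q.1.div2, q.2.1.div2, k q.1.bodd q.2.1.bodd q.2.2.1, s q.1.bodd q.2.1.bodd q.2.2.1 :: q.2.2.2)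

/-- A serial computation on two numbers with a carry, long enough to use up both numbers. -/
def serial (s k : Bool → Bool → Bool → Bool) (a b : ℕ) : ℕ × ℕ × Bool × List Bool :=
  -- The list only serves as a clock: it ticks often enough to exhaust both numbers and the last
  -- carry. Results are consed, so the most significant digit ends up first, as `ofBits` expects.
  (a.bits ++ b.bits ++ [false]).foldl (fun q _ => serialStep s k q) (a, b, false, [])

theorem foldl_serialStep (s k : Bool → Bool → Bool → Bool) (l : List Bool)
    (q : ℕ × ℕ × Bool × List Bool) :
    (l.foldl (fun q _ => serialStep s k q) q).1 = q.1 / 2 ^ l.length ∧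
    (l.foldl (fun q _ => serialStep s k q) q).2.1 = q.2.1 / 2 ^ l.length ∧
    (l.foldl (fun q _ => serialStep s k q) q).2.2.2.length = q.2.2.2.length + l.length := by
  induction l generalizing q with
  | nil => simp
  | cons b l ih =>
    obtain ⟨h1, h2, h3⟩ := ih (serialStep s k q)
    rw [List.foldl_cons, h1, h2, h3]
    simp only [serialStep, Nat.div2_val, Nat.div_div_eq_div_mul, List.length_cons, pow_succ,
      mul_comm]
    exact ⟨trivial, trivial, by ring⟩

theorem serial_spec (s k : Bool → Bool → Bool → Bool) (a b : ℕ) :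
    (serial s k a b).1 = 0 ∧ (serial s k a b).2.1 = 0 ∧
      a + b < 2 ^ (serial s k a b).2.2.2.length := by
  obtain ⟨h1, h2, h3⟩ := foldl_serialStep s k (a.bits ++ b.bits ++ [false]) (a, b, false, [])
  have ha := Nat.lt_size_self a
  have hb := Nat.lt_size_self b
  have hl : (a.bits ++ b.bits ++ [false]).length = a.size + b.size + 1 := by
    simp [length_bits, add_assoc]
  have ha' : 2 ^ a.size ≤ 2 ^ (a.size + b.size) := Nat.pow_le_pow_right (by simp) (by omega)
  have hb' : 2 ^ b.size ≤ 2 ^ (a.size + b.size) := Nat.pow_le_pow_right (by simp) (by omega)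
  unfold serial
  rw [h1, h2, h3, hl, pow_succ]
  refine ⟨Nat.div_eq_of_lt ?_, Nat.div_eq_of_lt ?_, ?_⟩
  · dsimp only; omega
  · dsimp only; omega
  · simp only [List.length_nil, zero_add, pow_succ]
    omega

theorem bodd_add_div2' (n : ℕ) : n = 2 * n.div2 + n.bodd.toNat := by
  have := Nat.bodd_add_div2 n
  omega

/-- Invariant: digits written, plus 2^(number of digits) times what remains of both summands and the
carry. A carry left at the end would contradict the size bound in `serial_spec`. -/
theorem add_eq_serial (a b : ℕ) :
    a + b = ofBits (serial (fun x y z => xor x (xor y z))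
      (fun x y z => (x && y) || (x && z) || (y && z)) a b).2.2.2 := by
  set s : Bool → Bool → Bool → Bool := fun x y z => xor x (xor y z) with hs
  set k : Bool → Bool → Bool → Bool := fun x y z => (x && y) || (x && z) || (y && z) with hk
  have step : ∀ q, ofBits (serialStep s k q).2.2.2 + 2 ^ (serialStep s k q).2.2.2.length *
      ((serialStep s k q).1 + (serialStep s k q).2.1 + (serialStep s k q).2.2.1.toNat) =
      ofBits q.2.2.2 + 2 ^ q.2.2.2.length * (q.1 + q.2.1 + q.2.2.1.toNat) := by
    rintro ⟨x, y, z, l⟩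
    simp only [serialStep, ofBits_cons, List.length_cons, pow_succ]
    conv_rhs => rw [bodd_add_div2' x, bodd_add_div2' y]
    cases x.bodd <;> cases y.bodd <;> cases z <;> simp [hs, hk] <;> ring
  have inv : ∀ (l : List Bool) q, ofBits (l.foldl (fun q _ => serialStep s k q) q).2.2.2 +
      2 ^ (l.foldl (fun q _ => serialStep s k q) q).2.2.2.length *
      ((l.foldl (fun q _ => serialStep s k q) q).1 + (l.foldl (fun q _ => serialStep s k q) q).2.1 +
        (l.foldl (fun q _ => serialStep s k q) q).2.2.1.toNat) =
      ofBits q.2.2.2 + 2 ^ q.2.2.2.length * (q.1 + q.2.1 + q.2.2.1.toNat) := by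
    intro l
    induction l with
    | nil => intro q; rfl
    | cons b l ih => intro q; rw [List.foldl_cons, ih, step]
  have h := inv (a.bits ++ b.bits ++ [false]) (a, b, false, [])
  obtain ⟨h1, h2, h3⟩ := serial_spec s k a b
  change ofBits (serial s k a b).2.2.2 + 2 ^ (serial s k a b).2.2.2.length *
    ((serial s k a b).1 + (serial s k a b).2.1 + (serial s k a b).2.2.1.toNat) = _ at h
  rw [h1, h2] at h
  simp only [ofBits, List.foldl_nil, List.length_nil, pow_zero, Bool.toNat_false, zero_add,
    add_zero, one_mul] at h
  cases hc : (serial s k a b).2.2.1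
  · rw [hc] at h
    simpa [ofBits] using h.symm
  · rw [hc] at h
    simp at h
    omega

/-- The invariant is the one of subtraction with borrow, arranged additively to avoid negative
numbers. A borrow left at the end means `a < b`, where truncated subtraction gives `0`. -/
theorem sub_eq_serial (a b : ℕ) :
    a - b = bif (serial (fun x y z => xor x (xor y z))
      (fun x y z => (!x && (y || z)) || (y && z)) a b).2.2.1 then 0 else
      ofBits (serial (fun x y z => xor x (xor y z))
      (fun x y z => (!x && (y || z)) || (y && z)) a b).2.2.2 := by
  set s : Bool → Bool → Bool → Bool := fun x y z => xor x (xor y z) with hs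
  set k : Bool → Bool → Bool → Bool := fun x y z => (!x && (y || z)) || (y && z) with hk
  have step : ∀ q : ℕ × ℕ × Bool × List Bool, ∀ u v : ℕ,
      ofBits q.2.2.2 + 2 ^ q.2.2.2.length * q.1 + v =
        u + 2 ^ q.2.2.2.length * (q.2.1 + q.2.2.1.toNat) →
      ofBits (serialStep s k q).2.2.2 + 2 ^ (serialStep s k q).2.2.2.length *
        (serialStep s k q).1 + v = u + 2 ^ (serialStep s k q).2.2.2.length *
        ((serialStep s k q).2.1 + (serialStep s k q).2.2.1.toNat) := by
    rintro ⟨x, y, z, l⟩ u v h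
    simp only [serialStep, ofBits_cons, List.length_cons, pow_succ]
    dsimp only at h
    rw [bodd_add_div2' x, bodd_add_div2' y] at h
    generalize 2 ^ l.length = m at *
    revert h
    cases x.bodd <;> cases y.bodd <;> cases z <;> simp [hs, hk] <;> intro h <;> nlinarith
  have inv : ∀ (l : List Bool) (q : ℕ × ℕ × Bool × List Bool), ∀ u v : ℕ,
      ofBits q.2.2.2 + 2 ^ q.2.2.2.length * q.1 + v =
        u + 2 ^ q.2.2.2.length * (q.2.1 + q.2.2.1.toNat) →
      ofBits (l.foldl (fun q _ => serialStep s k q) q).2.2.2 +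
      2 ^ (l.foldl (fun q _ => serialStep s k q) q).2.2.2.length *
      (l.foldl (fun q _ => serialStep s k q) q).1 + v = u +
      2 ^ (l.foldl (fun q _ => serialStep s k q) q).2.2.2.length *
      ((l.foldl (fun q _ => serialStep s k q) q).2.1 +
        (l.foldl (fun q _ => serialStep s k q) q).2.2.1.toNat) := by
    intro l
    induction l with
    | nil => intro q u v h; exact h
    | cons b l ih => intro q u v h; exact ih _ u v (step q u v h)
  have h : ofBits (serial s k a b).2.2.2 + 2 ^ (serial s k a b).2.2.2.length *
      (serial s k a b).1 + b = a + 2 ^ (serial s k a b).2.2.2.length *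
      ((serial s k a b).2.1 + (serial s k a b).2.2.1.toNat) :=
    inv (a.bits ++ b.bits ++ [false]) (a, b, false, []) a b (by simp [ofBits])
  obtain ⟨h1, h2, h3⟩ := serial_spec s k a b
  have hlt := ofBits_lt (serial s k a b).2.2.2
  rw [h1, h2] at h
  cases hc : (serial s k a b).2.2.1
  · rw [hc] at h
    simp at h ⊢
    omega
  · rw [hc] at h
    simp at h ⊢
    omega

namespace PolyTime

@[fun_prop]
theorem bits {f : α → ℕ} (hf : PolyTime f) : PolyTime fun x => (f x).bits :=
  comp (g := Nat.bits) (of_enc_eq fun _ => rfl) hf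

@[fun_prop]
theorem eq_zero {f : α → ℕ} (hf : PolyTime f) : PolyTime fun x => decide (f x = 0) := by
  have := (bits hf).isEmpty
  convert! this using 2 with x
  by_cases h : f x = 0
  · simp [h]
  · have : (f x).bits ≠ [] := fun h' => h (by
      have := ofBits_bits_reverse (f x)
      rw [h'] at this
      exact this.symm)
    cases hb : (f x).bits <;> simp_all

@[fun_prop]
theorem div2 {f : α → ℕ} (hf : PolyTime f) : PolyTime fun x => (f x).div2 := by
  have : PolyTime fun x => (f x).bits.tail := by fun_prop
  refine this.congr_enc fun x => ?_
  rw [← Nat.div2_bits_eq_tail]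
  rfl

@[fun_prop]
theorem bodd {f : α → ℕ} (hf : PolyTime f) : PolyTime fun x => (f x).bodd := by
  have : PolyTime fun x => (f x).bits.head?.elim false (fun b => b) :=
    elim (by fun_prop) (const _) (by fun_prop)
  convert! this using 2 with x
  rw [Nat.bodd_eq_bits_head]
  cases (f x).bits <;> rfl

@[fun_prop]
theorem bit {c : α → Bool} {f : α → ℕ} (hc : PolyTime c) (hf : PolyTime f) :
    PolyTime fun x => Nat.bit (c x) (f x) := by
  have : PolyTime fun x => cond (decide (f x = 0) && !c x) [] (c x :: (f x).bits) := by fun_prop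
  refine this.congr_enc fun x => ?_
  change enc (Nat.bits _) = _
  by_cases h : f x = 0 → c x = true
  · rw [Nat.bits_append_bit _ _ h]
    by_cases h' : f x = 0
    · simp [h', h h']
    · simp [h']
  · simp only [Classical.not_imp, Bool.not_eq_true] at h
    simp [h.1, h.2]

@[fun_prop]
theorem ofBits {l : α → List Bool} (hl : PolyTime l) : PolyTime fun x => ofBits (l x) :=
  foldl_of_growth hl (const 0) (step := fun _ n b => Nat.bit b n) (by fun_prop) (.const 4)
    fun _ n b _ => size_bit_le b n

theorem serial (s k : Bool → Bool → Bool → Bool) {f g : α → ℕ} (hf : PolyTime f)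
    (hg : PolyTime g) : PolyTime fun x => serial s k (f x) (g x) := by
  refine foldl_of_growth (by fun_prop) (init := fun x => (f x, g x, false, [])) (by fun_prop)
    (step := fun _ q _ => serialStep s k q) ?_ (b := fun _ => 6) (.const 6) ?_
  · unfold serialStep
    have h (s : Bool → Bool → Bool → Bool) : PolyTime fun p : α × (ℕ × ℕ × Bool × List Bool) × Bool =>
        s p.2.1.1.bodd p.2.1.2.1.bodd p.2.1.2.2.1 :=
      comp (f := fun p : α × (ℕ × ℕ × Bool × List Bool) × Bool =>
        (p.2.1.1.bodd, p.2.1.2.1.bodd, p.2.1.2.2.1)) (of_bool₃ s) (by fun_prop)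
    exact prodMk (by fun_prop) (prodMk (by fun_prop) (prodMk (h k) (cons (h s) (by fun_prop))))
  · rintro x ⟨a, b, c, l⟩ _ _
    have h1 := size_div2_le a
    have h2 := size_div2_le b
    have h3 := size_bool_le (s a.bodd b.bodd c)
    have h4 := size_bool_le (k a.bodd b.bodd c)
    have h5 := size_pos c
    simp only [serialStep, size_pair, size_listCons]
    omega

@[fun_prop]
theorem add {f g : α → ℕ} (hf : PolyTime f) (hg : PolyTime g) :
    PolyTime fun x => f x + g x := by
  simp only [add_eq_serial]
  have := serial (fun x y z => xor x (xor y z))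
    (fun x y z => (x && y) || (x && z) || (y && z)) hf hg
  fun_prop

@[fun_prop]
theorem sub {f g : α → ℕ} (hf : PolyTime f) (hg : PolyTime g) :
    PolyTime fun x => f x - g x := by
  simp only [sub_eq_serial]
  have := serial (fun x y z => xor x (xor y z))
    (fun x y z => (!x && (y || z)) || (y && z)) hf hg
  fun_prop

@[fun_prop]
-- Horner's scheme on the binary digits of `f x`. Each partial result is the number formed by the
-- leading digits times `g x`, so its bit length is at most the sum of those of the factors.
theorem mul {f g : α → ℕ} (hf : PolyTime f) (hg : PolyTime g) :
    PolyTime fun x => f x * g x := by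
  have key : ∀ (l : List Bool) (n m : ℕ),
      l.foldl (fun s b => s + s + cond b m 0) (n * m) = l.foldl (fun n b => Nat.bit b n) n * m := by
    intro l
    induction l with
    | nil => intro n m; rfl
    | cons b l ih =>
      intro n m
      rw [List.foldl_cons, List.foldl_cons, ← ih]
      cases b <;> simp [Nat.bit] <;> ring_nf
  have : PolyTime fun x => (f x).bits.reverse.foldl (fun s b => s + s + cond b (g x) 0) 0 := by
    refine foldl (by fun_prop) (const 0) (step := fun x s b => s + s + cond b (g x) 0)
      ?_ (b := fun x => 4 * (size (f x) + size (g x)) + 1) ?_ ?_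
    · have : PolyTime fun p : α × ℕ × Bool => g p.1 := comp hg (by fun_prop)
      fun_prop
    · exact ((PolyBound.const 4).mul (hf.size_bound.add hg.size_bound)).add (.const 1)
    · intro x l₁ hl₁
      refine size_nat_le_of_lt ?_
      have h0 := key l₁ 0 (g x)
      rw [zero_mul] at h0
      rw [h0]
      have h1 := ofBits_lt l₁
      have h2 := lt_two_pow_size (g x)
      have h3 : l₁.length ≤ size (f x) := hl₁.length_le.trans (by
        rw [List.length_reverse]; exact (length_lt_size _).le)
      calc StackProg.ofBits l₁ * g x < 2 ^ l₁.length * 2 ^ size (g x) :=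
            Nat.mul_lt_mul'' h1 h2
        _ ≤ 2 ^ (size (f x) + size (g x)) := by
            rw [← pow_add]; exact Nat.pow_le_pow_right (by simp) (by omega)
  convert! this using 2 with x
  have h0 := key (f x).bits.reverse 0 (g x)
  rw [zero_mul] at h0
  rw [h0]
  change _ = StackProg.ofBits _ * _
  rw [ofBits_bits_reverse]

@[fun_prop]
theorem eq_nat {f g : α → ℕ} (hf : PolyTime f) (hg : PolyTime g) :
    PolyTime fun x => decide (f x = g x) := by
  have : PolyTime fun x => decide (f x - g x = 0) && decide (g x - f x = 0) := by fun_prop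
  convert! this using 2 with x
  rw [← Bool.decide_and]
  congr 1
  rw [eq_iff_iff]
  omega

@[fun_prop]
theorem length {l : α → List β} (hl : PolyTime l) : PolyTime fun x => (l x).length := by
  have key : ∀ (l : List β) (n : ℕ), l.foldl (fun n _ => n + 1) n = n + l.length := by
    intro l
    induction l with
    | nil => intro n; rfl
    | cons y l ih => intro n; rw [List.foldl_cons, ih, List.length_cons]; omega
  have : PolyTime fun x => (l x).foldl (fun n _ => n + 1) 0 := by
    refine foldl hl (const 0) (step := fun _ n _ => n + 1) (by fun_prop)
      (b := fun x => 4 * size (l x) + 1) (((PolyBound.const 4).mul hl.size_bound).add (.const 1)) ?_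
    intro x l₁ hl₁
    refine size_nat_le_of_lt ?_
    rw [key, zero_add]
    exact (hl₁.length_le.trans_lt (length_lt_size _)).trans Nat.lt_two_pow_self
  simpa [key] using this

end PolyTime

end StackProg

/-! ### Strings of symbols as input and output -/

namespace StackProg

open MatchingGame (Symbol)

variable {α β γ δ : Type} [Enc α] [Enc β] [Enc γ] [Enc δ]

/-- Symbols as triples of bits. -/
def toBools : Symbol → Bool × Bool × Bool
  | .bit b => (false, false, b)
  | .slash => (false, true, false)
  | .vertex => (false, true, true)
  | .player => (true, false, false)
  | .nonEdge => (true, false, true)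
  | .endEntry => (true, true, false)
  | .endRow => (true, true, true)

/-- The inverse of `toBools`. -/
def ofBools : Bool → Bool → Bool → Symbol
  | false, false, b => .bit b
  | false, true, false => .slash
  | false, true, true => .vertex
  | true, false, false => .player
  | true, false, true => .nonEdge
  | true, true, false => .endEntry
  | true, true, true => .endRow

theorem ofBools_toBools (s : Symbol) :
    ofBools (toBools s).1 (toBools s).2.1 (toBools s).2.2 = s := by
  cases s <;> rfl

instance : Enc Symbol := ⟨fun s => enc (toBools s)⟩

theorem size_symbol_le (s : Symbol) : size s ≤ 11 := by
  change size (toBools s) ≤ 11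
  have h := fun b => size_bool_le b
  have h1 := h (toBools s).1
  have h2 := h (toBools s).2.1
  have h3 := h (toBools s).2.2
  simp only [size_pair]
  omega

theorem size_string_le (l : List Symbol) : size l ≤ 12 * l.length + 1 := by
  induction l with
  | nil => simp
  | cons s l ih =>
    have := size_symbol_le s
    simp only [size_listCons, List.length_cons]
    omega

theorem PolyTime.of_symbol (f : Symbol → β) : PolyTime f := by
  have : PolyTime fun s : Symbol => (fun p : Bool × Bool × Bool => f (ofBools p.1 p.2.1 p.2.2))
      (toBools s) :=
    comp (g := fun p : Bool × Bool × Bool => f (ofBools p.1 p.2.1 p.2.2))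
      (of_bool₃ fun a b c => f (ofBools a b c)) (of_enc_eq fun _ => rfl)
  simpa only [ofBools_toBools] using this

@[fun_prop]
theorem PolyTime.eq_symbol {f : α → Symbol} (hf : PolyTime f) (s : Symbol) :
    PolyTime fun x => decide (f x = s) :=
  comp (of_symbol fun t => decide (t = s)) hf

namespace Prog

/-- Replace the input string by the code of a list of symbols. -/
def readInput : Prog :=
  .seq (.loop .a (fun o => o.isSome) (.move .a (fun j => j = .b)))
    (.seq (.push .a (.bit false)) (.loop .b (fun o => o.isSome)
      (.branch .b fun o => .seq (drop .b) (pushWord (.bit true :: (enc (o.getD .slash)).code)))))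

/-- Read the code of a truth value and continue accordingly. -/
def readBool (f : Bool → Prog) : Prog :=
  .branch .a fun o => if o = some (.bit true) then .seq (drop .a) (.seq (drop .a)
    (.seq (drop .a) (f true))) else .seq (drop .a) (f false)

/-- Decode a symbol and push it on the second stack. -/
def readSymbol : Prog :=
  .seq (drop .a) (readBool fun x => .seq (drop .a) (readBool fun y => readBool fun z =>
    .push .b (ofBools x y z)))

/-- Replace the code of a list of symbols by this list. -/
def writeOutput : Prog :=
  .seq (.loop .a (fun o => o = some (.bit true)) (.seq (drop .a) readSymbol))
    (.seq (drop .a) (.loop .b (fun o => o.isSome) (.move .b (fun j => j = .a))))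

end Prog

open Prog

theorem exec_readInput (l : List Symbol) : ∃ t ≤ 18 * l.length + 3,
    Exec readInput (store l [] [] []) (store (enc l).code [] [] []) t := by
  have h1 : ∀ l B : List Symbol,
      Exec (.loop .a (fun o => o.isSome) (.move .a (fun j => j = .b)))
        (store l B [] []) (store [] (l.reverse ++ B) [] []) (2 * l.length + 1) := by
    intro l
    induction l with
    | nil => intro B; exact .loop_done rfl
    | cons s l ih =>
      intro B
      refine (Exec.loop_next rfl ((Exec.move _ _ _ s l rfl).congr (store_ext (B := s :: B)
        rfl rfl rfl rfl) rfl) (ih _)).congr (by simp) ?_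
      simp only [List.length_cons]; omega
  have h2 : ∀ l m : List Symbol, ∃ t ≤ 16 * l.length + 1,
      Exec (.loop .b (fun o => o.isSome)
        (.branch .b fun o => .seq (drop .b) (pushWord (.bit true :: (enc (o.getD .slash)).code))))
        (store (enc m).code l [] []) (store (enc (l.reverse ++ m)).code [] [] []) t := by
    intro l
    induction l with
    | nil => intro m; exact ⟨1, by simp, .loop_done rfl⟩
    | cons s l ih =>
      intro m
      obtain ⟨t, ht, h⟩ := ih (s :: m)
      refine ⟨_, ?_, Exec.loop_next rfl (.branch ((exec_drop_b _ _ _ _ s).seq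
        (exec_pushWord _ _ _ _ _))) (h.congr' ?_ |>.congr ?_ rfl)⟩
      · have := size_symbol_le s
        simp only [size] at this
        simp only [List.length_cons, store, List.head?_cons, Option.getD_some]
        omega
      · simp [BTree.code, store]
      · simp
  obtain ⟨t, ht, h⟩ := h2 l.reverse []
  refine ⟨_, ?_, (h1 l []).seq (((exec_push_a _ _ _ _ _).congr (S'' := store (enc ([] :
    List Symbol)).code l.reverse [] []) ?_ rfl).seq (h.congr ?_ rfl))⟩
  · rw [List.length_reverse] at ht; omega
  · simp [BTree.code]
  · simp

theorem exec_readBool (f : Bool → Prog) (b : Bool) (A B C D : List Symbol) (S : Store) (t : ℕ)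
    (h : Exec (f b) (store A B C D) S t) :
    ∃ t' ≤ t + 4, Exec (readBool f) (store ((enc b).code ++ A) B C D) S t' := by
  cases b with
  | true =>
    exact ⟨_, by omega, .branch ((exec_drop_a _ _ _ _ _).seq ((exec_drop_a _ _ _ _ _).seq
      ((exec_drop_a _ _ _ _ _).seq h)))⟩
  | false => exact ⟨_, by omega, .branch ((exec_drop_a _ _ _ _ _).seq h)⟩

theorem exec_readSymbol (s : Symbol) (A B C D : List Symbol) : ∃ t ≤ 15,
    Exec readSymbol (store ((enc s).code ++ A) B C D) (store A (s :: B) C D) t := by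
  have h3 := exec_push_b A B C D (ofBools (toBools s).1 (toBools s).2.1 (toBools s).2.2)
  obtain ⟨t2, ht2, h2⟩ := exec_readBool
    (fun z => .push .b (ofBools (toBools s).1 (toBools s).2.1 z)) _ _ _ _ _ _ _ h3
  obtain ⟨t1, ht1, h1⟩ := exec_readBool
    (fun y => readBool fun z => .push .b (ofBools (toBools s).1 y z)) _ _ _ _ _ _ _ h2
  obtain ⟨t0, ht0, h0⟩ := exec_readBool (fun x => .seq (drop .a) (readBool fun y => readBool fun z =>
    .push .b (ofBools x y z))) _ _ _ _ _ _ _ ((exec_drop_a _ _ _ _ (.bit true)).seq h1)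
  refine ⟨_, ?_, (((exec_drop_a _ _ _ _ (.bit true)).seq h0).congr' ?_).congr ?_ rfl⟩
  · omega
  · change store ((enc (toBools s)).code ++ A) B C D = _
    simp [BTree.code]
  · rw [ofBools_toBools]

theorem exec_writeOutput (l : List Symbol) : ∃ t ≤ 19 * l.length + 3,
    Exec writeOutput (store (enc l).code [] [] []) (store l [] [] []) t := by
  have h1 : ∀ l A : List Symbol,
      Exec (.loop .b (fun o => o.isSome) (.move .b (fun j => j = .a)))
        (store A l [] []) (store (l.reverse ++ A) [] [] []) (2 * l.length + 1) := by
    intro l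
    induction l with
    | nil => intro A; exact .loop_done rfl
    | cons s l ih =>
      intro A
      refine (Exec.loop_next rfl ((Exec.move _ _ _ s l rfl).congr (store_ext (A := s :: A)
        rfl rfl rfl rfl) rfl) (ih _)).congr (by simp) ?_
      simp only [List.length_cons]; omega
  have h2 : ∀ l B : List Symbol, ∃ t ≤ 17 * l.length + 1,
      Exec (.loop .a (fun o => o = some (.bit true)) (.seq (drop .a) readSymbol))
        (store (enc l).code B [] []) (store [.bit false] (l.reverse ++ B) [] []) t := by
    intro l
    induction l with
    | nil => intro B; exact ⟨1, by simp, .loop_done rfl⟩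
    | cons s l ih =>
      intro B
      obtain ⟨t, ht, h⟩ := ih (s :: B)
      obtain ⟨t', ht', h'⟩ := exec_readSymbol s (enc l).code B [] []
      refine ⟨_, ?_, Exec.loop_next rfl ((exec_drop_a _ _ _ _ (.bit true)).seq h')
        (h.congr ?_ rfl)⟩
      · simp only [List.length_cons]; omega
      · simp
  obtain ⟨t, ht, h⟩ := h2 l []
  refine ⟨_, ?_, h.seq ((exec_drop_a _ _ _ _ _).seq ((h1 _ []).congr ?_ rfl))⟩
  · simp only [List.length_reverse, List.append_nil]; omega
  · simp

/-- A polynomial time function on strings is computed by a Turing machine in polynomial time. -/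
theorem PolyTime.computable {X Y : Type} {ea : X → List Symbol} {eb : Y → List Symbol} {f : X → Y}
    {g : List Symbol → List Symbol} (hg : PolyTime g) (h : ∀ x, eb (f x) = g (ea x)) :
    Nonempty (Turing.TM2ComputableInPolyTime ea eb f) := by
  obtain ⟨Q, hQ⟩ := hg.size_bound
  obtain ⟨p, T, ⟨P, hP⟩, hp⟩ := hg
  refine Prog.computable (.seq readInput (.seq p writeOutput))
    (18 * .X + 3 + (P.comp (12 * .X + 1) + (19 * Q.comp (12 * .X + 1) + 3))) fun x => ?_
  obtain ⟨t₁, ht₁, h₁⟩ := exec_readInput (ea x)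
  obtain ⟨t₂, ht₂, h₂⟩ := hp (ea x) [] [] [] []
  obtain ⟨t₃, ht₃, h₃⟩ := exec_writeOutput (g (ea x))
  rw [List.append_nil, List.append_nil] at h₂
  refine ⟨_, ?_, h₁.seq (h₂.seq (h₃.congr (by rw [h]) rfl))⟩
  have h4 := size_string_le (ea x)
  have h5 := (ht₂.trans (hP _)).trans (P.eval_nat_mono h4)
  have h6 := ((length_lt_size _).le.trans (hQ (ea x))).trans (Q.eval_nat_mono h4)
  simp only [Polynomial.eval_add, Polynomial.eval_mul, Polynomial.eval_comp, Polynomial.eval_X,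
    Polynomial.eval_ofNat, Polynomial.eval_one]
  dsimp only at h5 h6
  omega

namespace PolyTime

/-- Iteration over a list, where every step adds a bounded amount to a measure of the size. -/
theorem foldl_of_measure {l : α → List β} {init : α → γ} {step : α → γ → β → γ}
    (hl : PolyTime l) (hi : PolyTime init)
    (hs : PolyTime fun p : α × γ × β => step p.1 p.2.1 p.2.2) (μ : γ → ℕ) (c : ℕ)
    (hμ : ∀ s, μ s ≤ size s) (hμ' : ∀ s, size s ≤ c * μ s + c)
    {b : α → ℕ} (hb : PolyBound b)
    (hsize : ∀ x s, ∀ y ∈ l x, μ (step x s y) ≤ μ s + b x) :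
    PolyTime fun x => (l x).foldl (step x) (init x) := by
  -- The measure `μ` grows additively, whereas `size` is comparable to it only up to the factor `c`.
  -- Passing from `μ` to `size` once, at the end, keeps this factor from compounding in every round.
  refine foldl hl hi hs (b := fun x => c * (size (init x) + size (l x) * b x) + c)
    (((PolyBound.const c).mul (hi.size_bound.add (hl.size_bound.mul hb))).add (.const c))
    fun x l₁ hl₁ => (hμ' _).trans ?_
  have key : ∀ (l₁ : List β) (s : γ), (∀ y ∈ l₁, y ∈ l x) →
      μ (l₁.foldl (step x) s) ≤ μ s + l₁.length * b x := by
    intro l₁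
    induction l₁ with
    | nil => simp
    | cons y l₁ ih =>
      intro s h
      have h1 := ih (step x s y) fun z hz => h z (by simp [hz])
      have h2 := hsize x s y (h y (by simp))
      simp only [List.foldl_cons, List.length_cons, Nat.add_mul]
      omega
  have h1 := hl₁.length_le.trans (length_lt_size _).le
  have h2 := (key l₁ (init x) fun y hy => hl₁.subset hy).trans
    (add_le_add (hμ (init x)) (Nat.mul_le_mul_right _ h1))
  gcongr

@[fun_prop]
theorem zipIdx {l : α → List β} (hl : PolyTime l) : PolyTime fun x => (l x).zipIdx := by
  have key : ∀ (l : List β) (n : ℕ) (r : List (β × ℕ)),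
      l.foldl (fun s y => (s.1 + 1, (y, s.1) :: s.2)) (n, r) =
        (n + l.length, (l.zipIdx n).reverse ++ r) := by
    intro l
    induction l with
    | nil => intro n r; rfl
    | cons y l ih =>
      intro n r
      simp only [List.foldl_cons, ih, List.zipIdx_cons, List.reverse_cons, List.append_assoc,
        List.length_cons, Prod.mk.injEq, List.singleton_append, and_true]
      omega
  have hsz : ∀ (l : List β) (n N : ℕ), n + l.length ≤ N →
      size (l.zipIdx n) ≤ size l + l.length * (4 * N + 2) := by
    intro l
    induction l with
    | nil => intro n N _; simp
    | cons y l ih =>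
      intro n N h
      simp only [List.length_cons] at h
      have h1 := ih (n + 1) N (by omega)
      have h2 := size_nat_le_of_lt (n := n) (k := n) Nat.lt_two_pow_self
      simp only [List.zipIdx_cons, size_listCons, size_pair, List.length_cons, Nat.add_mul] at h1 ⊢
      omega
  have hrev : ∀ l : List (β × ℕ), size l.reverse = size l := by
    intro l
    induction l with
    | nil => rfl
    | cons y l ih =>
      have := size_append l.reverse [y]
      simp only [List.reverse_cons, size_listCons, size_listNil] at this ⊢
      omega
  have : PolyTime fun x => ((l x).foldl (fun s y => (s.1 + 1, (y, s.1) :: s.2))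
      ((0, []) : ℕ × List (β × ℕ))).2.reverse := by
    refine reverse (snd (foldl hl (const _)
      (step := fun _ s y => (s.1 + 1, (y, s.1) :: s.2)) (by fun_prop)
      (b := fun x => (4 * size (l x) + 1) +
        (size (l x) + size (l x) * (4 * size (l x) + 2)) + 1) ?_ ?_))
    · have h := hl.size_bound
      have h4 := (PolyBound.const 4).mul h
      exact ((h4.add (.const 1)).add (h.add (h.mul (h4.add (.const 2))))).add (.const 1)
    · intro x l₁ hl₁
      have h0 := hl₁.length_le.trans_lt (length_lt_size _)
      have h1 := hsz l₁ 0 (size (l x)) (by omega)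
      have h2 : size l₁ ≤ size (l x) := by
        obtain ⟨l₂, h⟩ := hl₁
        have := size_append l₁ l₂
        have := size_pos l₂
        rw [← h]
        omega
      have h3 := size_nat_le_of_lt (n := l₁.length) (k := l₁.length) Nat.lt_two_pow_self
      have h5 := Nat.mul_le_mul_right (4 * size (l x) + 2) h0.le
      rw [key]
      simp only [size_pair, List.append_nil, hrev, zero_add]
      omega
  convert! this using 2 with x
  rw [key]
  simp

@[fun_prop]
theorem range {f : α → List β} (hf : PolyTime f) : PolyTime fun x => List.range (f x).length := by
  have : PolyTime fun x => (f x).zipIdx.map fun p => p.2 :=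
    map (zipIdx hf) (f := fun _ (p : β × ℕ) => p.2) (by fun_prop)
  convert! this using 2 with x
  rw [List.zipIdx_map_snd]
  exact List.range_eq_range'

@[fun_prop]
theorem take {l : α → List β} {f : α → ℕ} (hl : PolyTime l) (hf : PolyTime f) :
    PolyTime fun x => (l x).take (f x) := by
  have key : ∀ (l : List β) (n k : ℕ), ((l.zipIdx n).filter fun p => !decide (k - (p.2 - n) = 0)).map
      (fun p => p.1) = l.take k := by
    intro l
    induction l with
    | nil => intro n k; simp
    | cons y l ih =>
      intro n k
      cases k with
      | zero => simp
      | succ k =>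
        rw [List.zipIdx_cons, List.filter_cons_of_pos (by simp), List.map_cons, List.take_succ_cons,
          ← ih (n + 1) k]
        congr 2
        refine List.filter_congr fun p hp => ?_
        have := List.le_snd_of_mem_zipIdx hp
        congr 2
        rw [eq_iff_iff]
        omega
  have : PolyTime fun x =>
      ((l x).zipIdx.filter fun p => !decide (f x - p.2 = 0)).map fun p => p.1 :=
    map (filter (zipIdx hl) (f := fun x (p : β × ℕ) => !decide (f x - p.2 = 0)) (by fun_prop))
      (f := fun _ (p : β × ℕ) => p.1) (by fun_prop)
  convert! this using 2 with x
  rw [← key (l x) 0 (f x)]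
  rfl

end PolyTime

end StackProg

/-! ### The algorithm -/

namespace MatchingGame

open StackProg (Enc PolyTime PolyBound)

/-- Whether a symbol belongs to the list of vertices. -/
def isVertexMark (s : Symbol) : Bool := decide (s = .vertex) || decide (s = .player)

/-- Split a string into the parts which are terminated by a symbol. -/
def chunks (c : Symbol) (l : List Symbol) : List (List Symbol) :=
  l.foldr (fun s r => if s = c then [] :: r else
    match r with
    -- Symbols behind the last terminator belong to no part and are dropped.
    | [] => []
    | h :: t => (s :: h) :: t) []

/-- The number written in binary, least significant bit first. -/
def bitsValue (l : List Symbol) : ℕ :=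
  StackProg.ofBits (l.map fun s => decide (s = .bit true)).reverse

/-- A directed edge with its weight as a fraction: start, end, numerator, denominator. -/
abbrev WEdge := ℕ × ℕ × ℕ × ℕ

/-- A vertex together with the weight of the edge leading to it. -/
abbrev WVertex := ℕ × ℕ × ℕ

/-- The edge described by the parts of an entry of the adjacency matrix, if any. -/
def chunksEdge (x y : ℕ) (c : List (List Symbol)) : List WEdge :=
  if c.tail.isEmpty = true then [] else
    [(x, y, bitsValue (c.head?.elim [] fun l => l), bitsValue (c.tail.head?.elim [] fun l => l))]

/-- The edge described by an entry of the adjacency matrix, if any. -/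
def entryEdge (x y : ℕ) (e : List Symbol) : List WEdge :=
  -- The added slash terminates the denominator. The mark of a non-edge then forms a single part,
  -- which is how `chunksEdge` recognises it.
  chunksEdge x y (chunks .slash (e ++ [.slash]))

/-- All directed edges of the graph described by a string. -/
def stringEdges (l : List Symbol) : List WEdge :=
  (chunks .endRow (l.filter fun s => !isVertexMark s)).zipIdx.flatMap fun r =>
    (chunks .endEntry r.1).zipIdx.flatMap fun e => entryEdge r.2 e.2 e.1

/-- The list of vertices described by a string. -/
def stringVertices (l : List Symbol) : List Symbol := l.filter isVertexMark

/-- The player described by a string. -/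
def stringPlayer (l : List Symbol) : ℕ :=
  ((stringVertices l).zipIdx.find? fun p => decide (p.1 = .player)).elim 0 fun p => p.2

/-- An edge from the end of a path to a vertex which is not on the path; paths are listed
backwards. -/
def findNext (E : List WEdge) (p : List WVertex) : Option WEdge :=
  E.find? fun e => decide (e.1 = p.head?.elim 0 fun v => v.1) &&
    !p.any fun v => decide (v.1 = e.2.1)

/-- Extend a path by one edge if possible. -/
def extend (E : List WEdge) (p : List WVertex) : List WVertex :=
  (findNext E p).elim p fun e => e.2 :: p

/-- The path from a vertex found by repeated extension. -/
def arm (E : List WEdge) (clock : List Symbol) (i : ℕ) : List WVertex :=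
  -- The fraction 0/1 at the start is a dummy, removed again by `tail`.
  (clock.foldl (fun p _ => extend E p) [(i, 0, 1)]).reverse.tail

/-- What the start of a path gains from joining the players on the path, as a fraction. -/
def gain (p : List WVertex) : ℕ × ℕ :=
  -- Truncated subtraction supplies the maximum with 0; likewise `fracMax` uses that (a − b) + b is
  -- the maximum of a and b.
  p.foldr (fun v g => (v.2.1 * g.2 - g.1 * v.2.2, v.2.2 * g.2)) (0, 1)

/-- The maximum of two fractions. -/
def fracMax (x y : ℕ × ℕ) : ℕ × ℕ := ((x.1 * y.2 - y.1 * x.2) + y.1 * x.2, x.2 * y.2)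

/-- The number of different vertices in a list. -/
def countVertices (p : List WVertex) : ℕ :=
  (p.foldr (fun v s => if s.any (fun u => decide (u = v.1)) = true then s else v.1 :: s) []).length

/-- Signed pairs of initial segments of a list. -/
def signedPrefixes (p : List WVertex) : List (Bool × List WVertex × List WVertex) :=
  -- The second component is the segment at which a function is evaluated, the third one the segment
  -- required to lie in the coalition. The two entries for `k` together express that the segment
  -- ends exactly after `k` vertices.
  ((List.range p.length).flatMap fun k =>
    [(true, p.take k, p.take k), (false, p.take k, p.take (k + 1))]) ++ [(true, p, p)]

/-- A sign and a fraction. -/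
abbrev Term := Bool × ℕ × ℕ

/-- The contribution of initial segments of two paths to the Shapley value. -/
def pairTerm (x y : Bool × List WVertex × List WVertex) : Term :=
  (cond x.1 y.1 (!y.1), (fracMax (gain x.2.1) (gain y.2.1)).1,
    -- Different vertices are counted because the arms overlap on a cycle, and also when the player
    -- has only one neighbour.
    (fracMax (gain x.2.1) (gain y.2.1)).2 * (countVertices (x.2.2 ++ y.2.2) + 1))

/-- All contributions of initial segments of two paths. -/
def pairTerms (p q : List WVertex) : List Term :=
  (signedPrefixes p).flatMap fun x => (signedPrefixes q).map fun y => pairTerm x y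

/-- Positive part, negative part and common denominator of a sum. -/
def sumTerms (l : List Term) : ℕ × ℕ × ℕ :=
  l.foldl (fun s t => (s.1 * t.2.2 + cond t.1 (t.2.1 * s.2.2) 0,
    s.2.1 * t.2.2 + cond t.1 0 (t.2.1 * s.2.2), s.2.2 * t.2.2)) (0, 0, 1)

/-- The difference of the two parts of a sum. -/
def finish (s : ℕ × ℕ × ℕ) : ℕ × ℕ := (s.1 - s.2.1, s.2.2)

/-- The Shapley value from the edges, the vertices and the player. -/
def solveEdges (E : List WEdge) (clock : List Symbol) (i : ℕ) : ℕ × ℕ :=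
  -- Searching the reversed edge list makes the second arm start with the other neighbour of the
  -- player, if there are two.
  finish (sumTerms (pairTerms (arm E clock i) (arm E.reverse clock i)))

/-- The Shapley value as a fraction, for an instance given as a string. -/
def solve (l : List Symbol) : ℕ × ℕ :=
  solveEdges (stringEdges l) (stringVertices l) (stringPlayer l)

end MatchingGame

/-! ### The algorithm runs in polynomial time -/

namespace StackProg.PolyTime

open MatchingGame

variable {α β γ : Type} [Enc α] [Enc β] [Enc γ]

@[fun_prop]
theorem chunks {l : α → List Symbol} (c : Symbol) (hl : PolyTime l) :
    PolyTime fun x => chunks c (l x) := by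
  refine foldr_cons hl (const []) (f := fun _ s r => if s = c then [] :: r else
    match r with
    | [] => []
    | h :: t => (s :: h) :: t) (ite (by fun_prop) (by fun_prop) ?_) (b := fun _ => 12) (.const 12) ?_
  · refine (list_cases (l := fun p : α × List (List Symbol) × Symbol => p.2.1) (by fun_prop)
      (const []) (g := fun p h t => (p.2.2 :: h) :: t) (by fun_prop)).congr_enc ?_
    rintro ⟨_, _ | ⟨h, t⟩, s⟩ <;> rfl
  · intro x r s _
    have := size_symbol_le s
    split_ifs
    · simp; omega
    · cases r <;> simp; omega

@[fun_prop]
theorem bitsValue {l : α → List Symbol} (hl : PolyTime l) : PolyTime fun x => bitsValue (l x) := by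
  have := map hl (f := fun _ s => decide (s = Symbol.bit true)) (by fun_prop)
  unfold MatchingGame.bitsValue
  fun_prop

theorem entryEdge : PolyTime fun p : ℕ × ℕ × List Symbol => entryEdge p.1 p.2.1 p.2.2 := by
  have h : PolyTime fun p : ℕ × ℕ × List (List Symbol) => chunksEdge p.1 p.2.1 p.2.2 := by
    unfold chunksEdge
    have h1 : PolyTime fun p : ℕ × ℕ × List (List Symbol) =>
        MatchingGame.bitsValue (p.2.2.head?.elim [] fun l => l) :=
      bitsValue (elim (by fun_prop) (const _) (by fun_prop))
    have h2 : PolyTime fun p : ℕ × ℕ × List (List Symbol) =>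
        MatchingGame.bitsValue (p.2.2.tail.head?.elim [] fun l => l) :=
      bitsValue (elim (by fun_prop) (const _) (by fun_prop))
    refine ite ?_ (const _) (by fun_prop)
    simp only [Bool.decide_eq_true]
    fun_prop
  have h1 : PolyTime fun p : ℕ × ℕ × List Symbol =>
      MatchingGame.chunks .slash (p.2.2 ++ [Symbol.slash]) := chunks _ (by fun_prop)
  exact comp (f := fun p : ℕ × ℕ × List Symbol => (p.1, p.2.1,
    MatchingGame.chunks .slash (p.2.2 ++ [Symbol.slash]))) h (by fun_prop)

theorem stringEdges : PolyTime stringEdges := by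
  have h1 : PolyTime fun l : List Symbol => MatchingGame.chunks .endRow
      (l.filter fun s => !isVertexMark s) :=
    chunks _ (filter id (comp (g := fun s => !isVertexMark s) (of_symbol _) (by fun_prop)))
  refine flatMap (zipIdx h1) ?_
  refine flatMap (zipIdx (chunks _ (by fun_prop))) ?_
  exact comp (f := fun p : (List Symbol × List Symbol × ℕ) × List Symbol × ℕ =>
    (p.1.2.2, p.2.2, p.2.1)) entryEdge (by fun_prop)

theorem stringVertices : PolyTime stringVertices :=
  filter id (comp (g := isVertexMark) (of_symbol _) (by fun_prop))

theorem stringPlayer : PolyTime stringPlayer :=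
  elim (find? (zipIdx stringVertices)
    (f := fun _ (p : Symbol × ℕ) => decide (p.1 = .player)) (by fun_prop)) (const 0) (by fun_prop)

theorem findNext : PolyTime fun x : List WEdge × List WVertex => findNext x.1 x.2 := by
  refine find? (by fun_prop) (and ?_ (not (any (by fun_prop) (by fun_prop))))
  have : PolyTime fun p : (List WEdge × List WVertex) × WEdge =>
      p.1.2.head?.elim 0 fun v => v.1 := elim (by fun_prop) (const 0) (by fun_prop)
  fun_prop

theorem extend : PolyTime fun x : List WEdge × List WVertex => extend x.1 x.2 :=
  elim findNext (by fun_prop) (by fun_prop)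

theorem arm : PolyTime fun x : List WEdge × List Symbol × ℕ => arm x.1 x.2.1 x.2.2 := by
  refine tail (reverse (foldl_of_growth (l := fun x : List WEdge × List Symbol × ℕ => x.2.1)
    (by fun_prop) (by fun_prop) (step := fun x p _ => MatchingGame.extend x.1 p)
    (comp (f := fun p : (List WEdge × List Symbol × ℕ) × List WVertex × Symbol => (p.1.1, p.2.1))
      extend (by fun_prop)) (b := size) .size ?_))
  intro x p _ _
  unfold MatchingGame.extend
  cases h : MatchingGame.findNext x.1 p with
  | none => simp
  | some e =>
    have := size_le_of_mem (List.mem_of_find?_eq_some h)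
    simp only [Option.elim_some, size_listCons, size_pair] at this ⊢
    omega

theorem natSize_le (n : ℕ) : n.size ≤ size n := Nat.size_le.2 (lt_two_pow_size n)

theorem size_le_natSize (n : ℕ) : size n ≤ 4 * n.size + 1 := size_nat_le_of_lt (Nat.lt_size_self n)

theorem natSize_mul_le (a b : ℕ) : (a * b).size ≤ a.size + b.size :=
  Nat.size_le.2 (by
    rw [pow_add]
    exact Nat.mul_lt_mul'' (Nat.lt_size_self a) (Nat.lt_size_self b))

theorem natSize_add_le (a b : ℕ) : (a + b).size ≤ max a.size b.size + 1 :=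
  Nat.size_le.2 (by
    have h1 := (Nat.lt_size_self a).trans_le
      (Nat.pow_le_pow_right (n := 2) (by simp) (le_max_left a.size b.size))
    have h2 := (Nat.lt_size_self b).trans_le
      (Nat.pow_le_pow_right (n := 2) (by simp) (le_max_right a.size b.size))
    rw [pow_succ]
    omega)

@[fun_prop]
theorem gain {l : α → List WVertex} (hl : PolyTime l) : PolyTime fun x => gain (l x) := by
  have : PolyTime fun x => (l x).reverse.foldl
      (fun (g : ℕ × ℕ) (v : WVertex) => (v.2.1 * g.2 - g.1 * v.2.2, v.2.2 * g.2)) (0, 1) := by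
    refine foldl_of_measure (by fun_prop) (const _)
      (step := fun _ (g : ℕ × ℕ) (v : WVertex) => (v.2.1 * g.2 - g.1 * v.2.2, v.2.2 * g.2)) (by fun_prop)
      -- Measured in bit lengths, each step adds at most the size of one entry. The constant 8 comes
      -- from two numbers at four symbols per bit; `sumTerms` has three numbers, hence 12.
      (fun g : ℕ × ℕ => max g.1.size g.2.size) 8 ?_ ?_ (b := fun x => size (l x)) hl.size_bound ?_
    · intro g
      have h1 := natSize_le g.1
      have h2 := natSize_le g.2
      simp only [size_pair]
      omega
    · intro g
      have h1 := size_le_natSize g.1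
      have h2 := size_le_natSize g.2
      simp only [size_pair]
      omega
    · intro x g v hv
      have h0 := size_le_of_mem (List.mem_reverse.1 hv)
      have h1 := natSize_le v.2.1
      have h2 := natSize_le v.2.2
      have h3 := Nat.size_le_size (Nat.sub_le (v.2.1 * g.2) (g.1 * v.2.2))
      have h4 := natSize_mul_le v.2.1 g.2
      have h5 := natSize_mul_le v.2.2 g.2
      simp only [size_pair] at h0
      dsimp only
      omega
  simpa [MatchingGame.gain] using this

@[fun_prop]
theorem countVertices {l : α → List WVertex} (hl : PolyTime l) :
    PolyTime fun x => countVertices (l x) := by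
  refine length (foldr_cons hl (const [])
    (f := fun _ v s => if s.any (fun u => decide (u = v.1)) = true then s else v.1 :: s)
    (ite ?_ (by fun_prop) (by fun_prop)) (b := fun x => size (l x)) hl.size_bound ?_)
  · simp only [Bool.decide_eq_true]
    exact any (by fun_prop) (by fun_prop)
  · intro x s v hv
    have := size_le_of_mem hv
    split_ifs
    · omega
    · simp only [size_listCons, size_pair] at this ⊢
      omega

@[fun_prop]
theorem signedPrefixes {l : α → List WVertex} (hl : PolyTime l) :
    PolyTime fun x => signedPrefixes (l x) := by
  have h : PolyTime fun l : List WVertex => (List.range l.length).flatMap fun k =>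
      [(true, l.take k, l.take k), (false, l.take k, l.take (k + 1))] :=
    flatMap (by fun_prop) (by fun_prop)
  exact comp (g := MatchingGame.signedPrefixes) (append h (by fun_prop)) hl

theorem pairTerm : PolyTime fun p : (Bool × List WVertex × List WVertex) ×
    (Bool × List WVertex × List WVertex) => pairTerm p.1 p.2 := by
  have hm {f g : (Bool × List WVertex × List WVertex) × (Bool × List WVertex × List WVertex) →
      ℕ × ℕ} (hf : PolyTime f) (hg : PolyTime g) : PolyTime fun p => fracMax (f p) (g p) := by
    unfold fracMax
    fun_prop
  have h1 := hm (f := fun p => MatchingGame.gain p.1.2.1) (g := fun p => MatchingGame.gain p.2.2.1)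
    (by fun_prop) (by fun_prop)
  exact prodMk (by fun_prop) (prodMk (fst h1) (mul (snd h1) (by fun_prop)))

theorem pairTerms : PolyTime fun p : List WVertex × List WVertex => pairTerms p.1 p.2 := by
  refine flatMap (signedPrefixes (by fun_prop)) (map (signedPrefixes (by fun_prop)) ?_)
  exact comp (f := fun p : ((List WVertex × List WVertex) × Bool × List WVertex × List WVertex) ×
    (Bool × List WVertex × List WVertex) => (p.1.2, p.2)) pairTerm (by fun_prop)

theorem sumTerms : PolyTime sumTerms := by
  refine foldl_of_measure id (const _) (step := fun _ (s : ℕ × ℕ × ℕ) (t : Term) =>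
    (s.1 * t.2.2 + cond t.1 (t.2.1 * s.2.2) 0,
      s.2.1 * t.2.2 + cond t.1 0 (t.2.1 * s.2.2), s.2.2 * t.2.2)) (by fun_prop)
    (fun s : ℕ × ℕ × ℕ => max (max s.1.size s.2.1.size) s.2.2.size) 12 ?_ ?_
    (b := fun l => size l + 1) (.add .size (.const 1)) ?_
  · intro s
    have h1 := natSize_le s.1
    have h2 := natSize_le s.2.1
    have h3 := natSize_le s.2.2
    simp only [size_pair]
    omega
  · intro s
    have h1 := size_le_natSize s.1
    have h2 := size_le_natSize s.2.1
    have h3 := size_le_natSize s.2.2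
    simp only [size_pair]
    omega
  · intro l s t ht
    have h0 := size_le_of_mem ht
    have h1 := natSize_le t.2.1
    have h2 := natSize_le t.2.2
    have h3 := natSize_add_le (s.1 * t.2.2) (cond t.1 (t.2.1 * s.2.2) 0)
    have h4 := natSize_add_le (s.2.1 * t.2.2) (cond t.1 0 (t.2.1 * s.2.2))
    have h5 := natSize_mul_le s.1 t.2.2
    have h6 := natSize_mul_le s.2.1 t.2.2
    have h7 := natSize_mul_le s.2.2 t.2.2
    have h8 := natSize_mul_le t.2.1 s.2.2
    have h9 : (cond t.1 (t.2.1 * s.2.2) 0).size ≤ (t.2.1 * s.2.2).size :=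
      Nat.size_le_size (by cases t.1 <;> simp)
    have h10 : (cond t.1 0 (t.2.1 * s.2.2)).size ≤ (t.2.1 * s.2.2).size :=
      Nat.size_le_size (by cases t.1 <;> simp)
    simp only [size_pair] at h0
    dsimp only
    omega

theorem solve : PolyTime solve := by
  have h1 := stringEdges
  have h2 := stringVertices
  have h3 := stringPlayer
  have h4 : PolyTime fun l => MatchingGame.arm (MatchingGame.stringEdges l)
      (MatchingGame.stringVertices l) (MatchingGame.stringPlayer l) :=
    comp (f := fun l => (MatchingGame.stringEdges l, MatchingGame.stringVertices l,
      MatchingGame.stringPlayer l)) arm (by fun_prop)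
  have h5 : PolyTime fun l => MatchingGame.arm (MatchingGame.stringEdges l).reverse
      (MatchingGame.stringVertices l) (MatchingGame.stringPlayer l) :=
    comp (f := fun l => ((MatchingGame.stringEdges l).reverse, MatchingGame.stringVertices l,
      MatchingGame.stringPlayer l)) arm (by fun_prop)
  have h6 := comp pairTerms (prodMk h4 h5)
  have h7 := comp sumTerms h6
  exact comp (g := finish) (by unfold finish; fun_prop) h7

theorem encodeFraction : PolyTime encodeFraction := by
  have h {f : ℕ × ℕ → ℕ} (hf : PolyTime f) : PolyTime fun x => encodeNat (f x) :=
    map (by fun_prop) (f := fun _ b => Symbol.bit b) (comp (of_bool Symbol.bit) (by fun_prop))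
  exact append (h (by fun_prop)) (cons (const _) (h (by fun_prop)))

end StackProg.PolyTime

/-! ### Shapley values of matching games on graphs of maximum degree two -/

namespace MatchingGame

/-- Each summand equals r! k! C(j + k, k), and the hockey-stick identity sums these binomials.
Combinatorially, one of r + k + 1 players comes after k given ones in a 1/(k + 1) fraction of all
orders. -/
theorem sum_choose_mul_factorial (r k : ℕ) :
    (∑ j ∈ Finset.range (r + 1), r.choose j * ((j + k)! * (r - j)!)) * (k + 1) = (r + k + 1)! := by
  have h1 : ∀ j ∈ Finset.range (r + 1),
      r.choose j * ((j + k)! * (r - j)!) = r ! * k ! * (j + k).choose k := by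
    intro j hj
    have hj : j ≤ r := Nat.lt_succ_iff.1 (Finset.mem_range.1 hj)
    have h2 := Nat.choose_mul_factorial_mul_factorial hj
    have h3 := Nat.add_choose_mul_factorial_mul_factorial j k
    rw [← h2, ← h3]
    ring
  rw [Finset.sum_congr rfl h1, ← Finset.mul_sum, Nat.sum_range_add_choose]
  have h4 := Nat.add_choose_mul_factorial_mul_factorial r (k + 1)
  rw [Nat.factorial_succ k] at h4
  rw [add_assoc r k 1, ← h4]
  ring

/-- The probability that a set of players precedes the player `i` in a random order. -/
theorem sum_coalitions {N : Type*} [Fintype N] [DecidableEq N] (i : N) (X : Finset N)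
    (hX : i ∉ X) :
    (∑ S ∈ (Finset.univ.erase i).powerset, ((S.card ! : ℝ) *
      ((Fintype.card N - S.card - 1)! : ℝ) * if X ⊆ S then 1 else 0)) / (Fintype.card N)! =
      1 / (X.card + 1) := by
  have hXU : X ⊆ Finset.univ.erase i := fun x hx => Finset.mem_erase.2
    ⟨fun h => hX (h ▸ hx), Finset.mem_univ x⟩
  -- `r` counts the players outside X ∪ {i}. A coalition containing `X` is `X` together with an
  -- arbitrary set `T` of these.
  obtain ⟨r, hr⟩ : ∃ r, (Finset.univ.erase i).card = r + X.card :=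
    ⟨_, (Nat.sub_add_cancel (Finset.card_le_card hXU)).symm⟩
  have hN : Fintype.card N = r + X.card + 1 := by
    rw [← hr, Finset.card_erase_add_one (Finset.mem_univ i), Finset.card_univ]
  have hsum : (∑ S ∈ (Finset.univ.erase i).powerset, ((S.card ! : ℝ) *
      ((Fintype.card N - S.card - 1)! : ℝ) * if X ⊆ S then 1 else 0)) =
      ∑ T ∈ (Finset.univ.erase i \ X).powerset,
        (((T.card + X.card)! * (r - T.card)! : ℕ) : ℝ) := by
    simp only [mul_ite, mul_one, mul_zero]
    rw [← Finset.sum_filter]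
    refine Finset.sum_bij' (fun S _ => S \ X) (fun T _ => T ∪ X) ?_ ?_ ?_ ?_ ?_
    · intro S hS
      simp only [Finset.mem_filter, Finset.mem_powerset] at hS ⊢
      exact Finset.sdiff_subset_sdiff hS.1 le_rfl
    · intro T hT
      simp only [Finset.mem_filter, Finset.mem_powerset] at hT ⊢
      exact ⟨Finset.union_subset (hT.trans Finset.sdiff_subset) hXU, Finset.subset_union_right⟩
    · intro S hS
      simp only [Finset.mem_filter, Finset.mem_powerset] at hS
      exact Finset.sdiff_union_of_subset hS.2
    · intro T hT
      simp only [Finset.mem_powerset] at hT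
      have : Disjoint T X := Finset.disjoint_of_subset_left hT Finset.sdiff_disjoint
      exact Finset.union_sdiff_cancel_right this
    · intro S hS
      simp only [Finset.mem_filter, Finset.mem_powerset] at hS
      have h1 := Finset.card_sdiff_add_card_eq_card hS.2
      have h2 := Finset.card_le_card hS.1
      rw [hr] at h2
      have h3 : r - (S \ X).card = Fintype.card N - S.card - 1 := by omega
      rw [h1, h3]
      push_cast
      rfl
  have hcard : (Finset.univ.erase i \ X).card = r := by
    have := Finset.card_sdiff_add_card_eq_card hXU
    omega
  rw [hsum, Finset.sum_powerset_apply_card (fun t => (((t + X.card)! * (r - t)! : ℕ) : ℝ)), hcard,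
    hN, ← sum_choose_mul_factorial]
  have hpos : (∑ j ∈ Finset.range (r + 1), r.choose j * ((j + X.card)! * (r - j)!) : ℕ) ≠ 0 := by
    intro h
    have := sum_choose_mul_factorial r X.card
    rw [h, zero_mul] at this
    exact Nat.factorial_ne_zero _ this.symm
  have hpos' : ((∑ j ∈ Finset.range (r + 1), r.choose j * ((j + X.card)! * (r - j)!) : ℕ) : ℝ) ≠ 0 :=
    Nat.cast_ne_zero.2 hpos
  have hcast : (∑ m ∈ Finset.range (r + 1),
      r.choose m • (((m + X.card)! * (r - m)! : ℕ) : ℝ)) =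
      ((∑ j ∈ Finset.range (r + 1), r.choose j * ((j + X.card)! * (r - j)!) : ℕ) : ℝ) := by
    push_cast
    simp
  rw [hcast, Nat.cast_mul, Nat.cast_add_one]
  generalize ((∑ j ∈ Finset.range (r + 1), r.choose j * ((j + X.card)! * (r - j)!) : ℕ) : ℝ) = q
    at hpos'
  field_simp

/-! ### The recursion for marginal contributions in a matching game. -/

section

variable {N : Type*} [Fintype N] {G : SimpleGraph N} {w : G.edgeSet → ℝ≥0}

theorem sum_le_matchingGame {S : Finset N} {M : Finset G.edgeSet} (hM : IsMatchingOn G S M) :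
    ((∑ e ∈ M, w e : ℝ≥0) : ℝ) ≤ matchingGame G w S := by
  classical
  exact NNReal.coe_le_coe.2 (Finset.le_sup (f := fun M : Finset G.edgeSet => ∑ e ∈ M, w e)
    (by simpa using hM))

theorem exists_matchingGame_eq (G : SimpleGraph N) (w : G.edgeSet → ℝ≥0) (S : Finset N) :
    ∃ M, IsMatchingOn G S M ∧ matchingGame G w S = ((∑ e ∈ M, w e : ℝ≥0) : ℝ) := by
  classical
  obtain ⟨M, hM, h⟩ := Finset.exists_mem_eq_sup (Finset.univ.filter (IsMatchingOn G S))
    ⟨∅, by simp [IsMatchingOn]⟩ (fun M : Finset G.edgeSet => ∑ e ∈ M, w e)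
  refine ⟨M, (Finset.mem_filter.1 hM).2, ?_⟩
  rw [← h, matchingGame]

theorem matchingGame_mono {S T : Finset N} (h : S ⊆ T) :
    matchingGame G w S ≤ matchingGame G w T := by
  obtain ⟨M, hM, hS⟩ := exists_matchingGame_eq G w S
  rw [hS]
  exact sum_le_matchingGame ⟨fun e he x hx => h (hM.1 e he x hx), hM.2⟩

variable [DecidableEq N]

/-- The edge uy can be added to an optimal matching of S \ {y}. -/
theorem add_le_matchingGame_insert {S : Finset N} {u y : N} (hu : u ∉ S) (hy : y ∈ S)
    (h : s(u, y) ∈ G.edgeSet) :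
    w ⟨s(u, y), h⟩ + matchingGame G w (S.erase y) ≤ matchingGame G w (insert u S) := by
  classical
  obtain ⟨M, hM, hS⟩ := exists_matchingGame_eq G w (S.erase y)
  have hdis : ∀ e' ∈ M, ∀ x ∈ s(u, y), x ∉ (e' : Sym2 N) := by
    intro e' he' x hx hx'
    have := hM.1 e' he' x hx'
    rcases Sym2.mem_iff.1 hx with rfl | rfl
    · exact hu (Finset.mem_of_mem_erase this)
    · simp at this
  have hne : (⟨s(u, y), h⟩ : G.edgeSet) ∉ M := fun hm => hdis _ hm u (by simp) (by simp)
  have hM' : IsMatchingOn G (insert u S) (insert ⟨s(u, y), h⟩ M) := by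
    refine ⟨?_, ?_⟩
    · intro e he x hx
      rcases Finset.mem_insert.1 he with rfl | he
      · rcases Sym2.mem_iff.1 hx with rfl | rfl
        · simp
        · simp [hy]
      · exact Finset.mem_insert_of_mem (Finset.mem_of_mem_erase (hM.1 e he x hx))
    · intro e he e' he' hee x hx hx'
      rcases Finset.mem_insert.1 he with rfl | he <;> rcases Finset.mem_insert.1 he' with rfl | he'
      · exact hee rfl
      · exact hdis e' he' x hx hx'
      · exact hdis e he x hx' hx
      · exact hM.2 e he e' he' hee x hx hx'
  have := sum_le_matchingGame (w := w) hM'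
  rw [Finset.sum_insert hne, NNReal.coe_add, ← hS] at this
  exact this

/-- An optimal matching of S ∪ {u} either leaves `u` free or matches it with some `y`; in the second
case the edge uy is deleted. -/
theorem matchingGame_insert_le (w : G.edgeSet → ℝ≥0) (S : Finset N) (u : N) :
    matchingGame G w (insert u S) ≤ matchingGame G w S ∨ ∃ y ∈ S, ∃ h : s(u, y) ∈ G.edgeSet,
      matchingGame G w (insert u S) ≤ w ⟨s(u, y), h⟩ + matchingGame G w (S.erase y) := by
  classical
  obtain ⟨M, hM, hS⟩ := exists_matchingGame_eq G w (insert u S)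
  by_cases hu : ∃ e ∈ M, u ∈ (e : Sym2 N)
  · right
    obtain ⟨⟨e, he⟩, heM, hue⟩ := hu
    obtain ⟨y, rfl⟩ := Sym2.mem_iff_exists.1 hue
    have hadj : G.Adj u y := he
    have hy : y ∈ S := by
      have := hM.1 _ heM y (by simp)
      exact (Finset.mem_insert.1 this).resolve_left hadj.ne'
    refine ⟨y, hy, he, ?_⟩
    have hM' : IsMatchingOn G (S.erase y) (M.erase ⟨s(u, y), he⟩) := by
      refine ⟨fun e' he' x hx => ?_, fun e₁ h₁ e₂ h₂ =>
        hM.2 e₁ (Finset.mem_of_mem_erase h₁) e₂ (Finset.mem_of_mem_erase h₂)⟩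
      obtain ⟨hne, he'⟩ := Finset.mem_erase.1 he'
      have hx1 := hM.1 e' he' x hx
      have hx2 := hM.2 e' he' _ heM hne x hx
      simp only [Sym2.mem_iff, not_or] at hx2
      exact Finset.mem_erase.2 ⟨hx2.2, (Finset.mem_insert.1 hx1).resolve_left hx2.1⟩
    have h1 := sum_le_matchingGame (w := w) hM'
    rw [hS, ← Finset.add_sum_erase _ _ heM, NNReal.coe_add]
    gcongr
  · left
    push Not at hu
    rw [hS]
    refine sum_le_matchingGame ⟨fun e he x hx => ?_, hM.2⟩
    exact (Finset.mem_insert.1 (hM.1 e he x hx)).resolve_left fun h => hu e he (h ▸ hx)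

/-- The marginal contribution of a player to a coalition. -/
noncomputable def marginal (w : G.edgeSet → ℝ≥0) (S : Finset N) (u : N) : ℝ :=
  matchingGame G w (insert u S) - matchingGame G w S

theorem marginal_nonneg (w : G.edgeSet → ℝ≥0) (S : Finset N) (u : N) : 0 ≤ marginal w S u :=
  sub_nonneg.2 (matchingGame_mono (Finset.subset_insert _ _))

theorem marginal_erase {S : Finset N} {y : N} (hy : y ∈ S) :
    marginal w (S.erase y) y = matchingGame G w S - matchingGame G w (S.erase y) := by
  rw [marginal, Finset.insert_erase hy]

/-- Splitting v(S) as v(S \ {y}) plus the marginal contribution of `y` turns the two bounds on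
`matchingGame` into a recursion in marginal contributions only. The other half is `marginal_le`. -/
theorem sub_marginal_le {S : Finset N} {u y : N} (hu : u ∉ S) (hy : y ∈ S)
    (h : s(u, y) ∈ G.edgeSet) : w ⟨s(u, y), h⟩ - marginal w (S.erase y) y ≤ marginal w S u := by
  have := add_le_matchingGame_insert (w := w) hu hy h
  rw [marginal_erase hy, marginal]
  linarith

theorem marginal_le (w : G.edgeSet → ℝ≥0) (S : Finset N) (u : N) :
    marginal w S u ≤ 0 ∨ ∃ y ∈ S, ∃ h : s(u, y) ∈ G.edgeSet,
      marginal w S u ≤ w ⟨s(u, y), h⟩ - marginal w (S.erase y) y := by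
  rcases matchingGame_insert_le w S u with h | ⟨y, hy, h, h'⟩
  · exact .inl (sub_nonpos.2 h)
  · refine .inr ⟨y, hy, h, ?_⟩
    rw [marginal_erase hy, marginal]
    linarith

end

end MatchingGame

/-! ### Marginal contributions computed along the two arms. -/

namespace MatchingGame

/-- The value of a fraction. -/
noncomputable def fracVal (x : ℕ × ℕ) : ℝ := x.1 / x.2

/-- What the start of a path gains from joining the players on the path. -/
noncomputable def gainVal (p : List WVertex) : ℝ := p.foldr (fun v g => max 0 (fracVal v.2 - g)) 0

theorem cast_tsub_eq_max (a b : ℕ) : ((a - b : ℕ) : ℝ) = max 0 ((a : ℝ) - b) := by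
  rcases le_total b a with h | h
  · rw [Nat.cast_sub h, max_eq_right (sub_nonneg.2 (Nat.cast_le.2 h))]
  · rw [Nat.sub_eq_zero_of_le h, max_eq_left (sub_nonpos.2 (Nat.cast_le.2 h)), Nat.cast_zero]

theorem gain_spec (p : List WVertex) (hp : ∀ v ∈ p, v.2.2 ≠ 0) :
    (gain p).2 ≠ 0 ∧ fracVal (gain p) = gainVal p := by
  induction p with
  | nil => simp [gain, gainVal, fracVal]
  | cons v p ih =>
    obtain ⟨h1, h2⟩ := ih fun u hu => hp u (by simp [hu])
    have hv := hp v (by simp)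
    change v.2.2 * (gain p).2 ≠ 0 ∧ (((v.2.1 * (gain p).2 - (gain p).1 * v.2.2 : ℕ) : ℝ) /
      ((v.2.2 * (gain p).2 : ℕ) : ℝ)) = max 0 (fracVal v.2 - gainVal p)
    refine ⟨mul_ne_zero hv h1, ?_⟩
    have hv' : (0 : ℝ) < v.2.2 := Nat.cast_pos.2 (Nat.pos_of_ne_zero hv)
    have h1' : (0 : ℝ) < (gain p).2 := Nat.cast_pos.2 (Nat.pos_of_ne_zero h1)
    rw [cast_tsub_eq_max, ← max_div_div_right (Nat.cast_nonneg _), ← h2, zero_div]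
    congr 1
    simp only [fracVal]
    push_cast
    field_simp

theorem fracMax_spec (x y : ℕ × ℕ) (hx : x.2 ≠ 0) (hy : y.2 ≠ 0) :
    (fracMax x y).2 ≠ 0 ∧ fracVal (fracMax x y) = max (fracVal x) (fracVal y) := by
  refine ⟨mul_ne_zero hx hy, ?_⟩
  have hx' : (0 : ℝ) < x.2 := Nat.cast_pos.2 (Nat.pos_of_ne_zero hx)
  have hy' : (0 : ℝ) < y.2 := Nat.cast_pos.2 (Nat.pos_of_ne_zero hy)
  simp only [fracVal, fracMax]
  rw [Nat.cast_add, cast_tsub_eq_max, ← max_add_add_right,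
    ← max_div_div_right (Nat.cast_nonneg _), max_comm]
  congr 1
  · push_cast
    field_simp
    ring
  · push_cast
    field_simp
    ring

section

variable {n : ℕ} {G : SimpleGraph (Fin n)} {w : G.edgeSet → ℝ≥0} {W : Fin n → Fin n → ℕ × ℕ}
  {E : List WEdge}

/-- `E` lists the edges of a graph in both directions, with their weights. -/
structure Represents (G : SimpleGraph (Fin n)) (w : G.edgeSet → ℝ≥0) (W : Fin n → Fin n → ℕ × ℕ)
    (E : List WEdge) : Prop where
  mem_iff : ∀ e, e ∈ E ↔ ∃ x y, G.Adj x y ∧ e = ((x : ℕ), (y : ℕ), W x y)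
  den_ne_zero : ∀ x y, (W x y).2 ≠ 0
  weight_eq : ∀ x y (h : s(x, y) ∈ G.edgeSet), (w ⟨s(x, y), h⟩ : ℝ) = fracVal (W x y)

theorem Represents.reverse (h : Represents G w W E) : Represents G w W E.reverse :=
  ⟨fun e => by rw [List.mem_reverse, h.mem_iff], h.den_ne_zero, h.weight_eq⟩

/-- The initial segment of a path inside a coalition. -/
def before (S : Finset (Fin n)) (p : List WVertex) : List WVertex :=
  p.takeWhile fun v => decide (v.1 ∈ S.image Fin.val)

/-- The members of a coalition who are not on a path. -/
def rest (S : Finset (Fin n)) (p : List WVertex) : Finset (Fin n) :=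
  S.filter fun x => ∀ v ∈ p, v.1 ≠ x

theorem val_mem_image {S : Finset (Fin n)} {x : Fin n} : (x : ℕ) ∈ S.image Fin.val ↔ x ∈ S :=
  Fin.val_injective.mem_finset_image

theorem rest_cons (S : Finset (Fin n)) (y : Fin n) (a : ℕ × ℕ) (p : List WVertex) :
    rest S (((y : ℕ), a) :: p) = (rest S p).erase y := by
  ext x
  simp only [rest, List.mem_cons, forall_eq_or_imp, Finset.mem_filter, Finset.mem_erase, ne_eq,
    Fin.val_inj, eq_comm (a := y)]
  tauto

/-- The path which extends a given path, by at most `k` vertices. -/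
def walk (E : List WEdge) : ℕ → List WVertex → List WVertex
  | 0, _ => []
  | k + 1, p => (findNext E p).elim [] fun e => e.2 :: walk E k (e.2 :: p)

/-- Once a path cannot be extended, further ticks of the clock leave it unchanged. The form `walk`
lists vertices forwards and suits induction. -/
theorem foldl_extend (E : List WEdge) (clock : List Symbol) (p : List WVertex) :
    clock.foldl (fun p _ => extend E p) p = (walk E clock.length p).reverse ++ p := by
  induction clock generalizing p with
  | nil => rfl
  | cons s clock ih =>
    rw [List.foldl_cons, ih, List.length_cons, walk, extend]
    cases h : findNext E p with
    | none =>
      cases clock with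
      | nil => rfl
      | cons t c => simp [walk, h]
    | some e => simp

theorem arm_eq_walk (E : List WEdge) (clock : List Symbol) (i : ℕ) :
    arm E clock i = walk E clock.length [(i, 0, 1)] := by
  simp [arm, foldl_extend]

theorem mem_walk {k : ℕ} {p : List WVertex} {v : WVertex} (hv : v ∈ walk E k p) :
    (∃ e ∈ E, e.2 = v) ∧ ∀ u ∈ p, u.1 ≠ v.1 := by
  induction k generalizing p with
  | zero => simp [walk] at hv
  | succ k ih =>
    rw [walk] at hv
    cases h : findNext E p with
    | none => simp [h] at hv
    | some e =>
      simp only [h, Option.elim_some, List.mem_cons] at hv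
      rcases hv with rfl | hv
      · refine ⟨⟨e, List.mem_of_find?_eq_some h, rfl⟩, fun u hu huv => ?_⟩
        have := List.find?_some h
        simp only [Bool.and_eq_true, Bool.not_eq_true', List.any_eq_false] at this
        exact this.2 u hu (by simpa using huv)
      · obtain ⟨h1, h2⟩ := ih hv
        exact ⟨h1, fun u hu => h2 u (by simp [hu])⟩

theorem Represents.findNext_eq_some (h : Represents G w W E) {x : Fin n} {a : ℕ × ℕ}
    {p : List WVertex} {e : WEdge} (he : findNext E (((x : ℕ), a) :: p) = some e) :
    ∃ y, G.Adj x y ∧ e = ((x : ℕ), (y : ℕ), W x y) ∧ ∀ v ∈ ((x : ℕ), a) :: p, v.1 ≠ y := by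
  obtain ⟨x', y, hxy, rfl⟩ := (h.mem_iff e).1 (List.mem_of_find?_eq_some he)
  have := List.find?_some he
  simp only [Bool.and_eq_true, Bool.not_eq_true', List.any_eq_false, List.head?_cons,
    Option.elim_some, decide_eq_true_eq, Fin.val_inj] at this
  obtain ⟨rfl, h2⟩ := this
  exact ⟨y, hxy, rfl, h2⟩

theorem Represents.findNext_eq_none (h : Represents G w W E) {x : Fin n} {a : ℕ × ℕ}
    {p : List WVertex} (he : findNext E (((x : ℕ), a) :: p) = none) {y : Fin n}
    (hxy : G.Adj x y) : ∃ v ∈ ((x : ℕ), a) :: p, v.1 = y := by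
  have := List.find?_eq_none.1 he _ ((h.mem_iff _).2 ⟨x, y, hxy, rfl⟩)
  simp at this ⊢
  tauto

/-- The gain of `x` from the neighbour `y`. -/
noncomputable def edgeGain (w : G.edgeSet → ℝ≥0) (W : Fin n → Fin n → ℕ × ℕ) (T : Finset (Fin n))
    (x y : Fin n) : ℝ :=
  if y ∈ T then max 0 (fracVal (W x y) - marginal w (T.erase y) y) else 0

theorem marginal_eq_zero (T : Finset (Fin n)) {x : Fin n}
    (h : ∀ z ∈ T, ¬ G.Adj x z) : marginal w T x = 0 := by
  refine le_antisymm ?_ (marginal_nonneg w T x)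
  rcases marginal_le w T x with h' | ⟨y, hy, hxy, _⟩
  · exact h'
  · exact absurd hxy (h y hy)

/-- The two neighbours may coincide; this case is used inside an arm, where only one neighbour is
left. -/
theorem Represents.marginal_eq_max (h : Represents G w W E) {T : Finset (Fin n)} {x y y' : Fin n}
    (hx : x ∉ T) (hy : G.Adj x y) (hy' : G.Adj x y') (hz : ∀ z ∈ T, G.Adj x z → z = y ∨ z = y') :
    marginal w T x = max (edgeGain w W T x y) (edgeGain w W T x y') := by
  have hle : ∀ z, G.Adj x z → edgeGain w W T x z ≤ marginal w T x := by
    intro z hxz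
    unfold edgeGain
    split_ifs with hzT
    · refine max_le (marginal_nonneg w T x) ?_
      rw [← h.weight_eq x z hxz]
      exact sub_marginal_le hx hzT hxz
    · exact marginal_nonneg w T x
  have h0 : ∀ z, 0 ≤ edgeGain w W T x z := by
    intro z
    unfold edgeGain
    split_ifs
    · exact le_max_left _ _
    · exact le_rfl
  refine le_antisymm ?_ (max_le (hle y hy) (hle y' hy'))
  rcases marginal_le w T x with h' | ⟨z, hzT, hxz, h'⟩
  · exact h'.trans ((h0 y).trans (le_max_left _ _))
  · rw [h.weight_eq] at h'
    have h2 : marginal w T x ≤ edgeGain w W T x z := by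
      rw [edgeGain, if_pos hzT]
      exact h'.trans (le_max_right _ _)
    rcases hz z hzT hxz with rfl | rfl
    · exact h2.trans (le_max_left _ _)
    · exact h2.trans (le_max_right _ _)

/-- One step of the recursion along an arm: if `y` is outside the coalition, the initial segment is
empty and the gain is 0 on both sides. -/
theorem gainVal_before_cons {S : Finset (Fin n)} {x y : Fin n} {p q : List WVertex}
    (hy : ∀ v ∈ p, v.1 ≠ y)
    (hq : marginal w (rest S (((y : ℕ), W x y) :: p)) y = gainVal (before S q)) :
    gainVal (before S (((y : ℕ), W x y) :: q)) = edgeGain w W (rest S p) x y := by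
  have hmem : y ∈ rest S p ↔ y ∈ S := by
    simp only [rest, Finset.mem_filter, and_iff_left_iff_imp]
    exact fun _ => hy
  unfold edgeGain before
  rw [List.takeWhile_cons]
  by_cases hyS : y ∈ S
  · rw [if_pos (hmem.2 hyS), if_pos (by simpa using val_mem_image.2 hyS), ← rest_cons, hq]
    rfl
  · rw [if_neg (fun h => hyS (hmem.1 h)),
      if_neg (by simpa using fun h => hyS (val_mem_image.1 h))]
    rfl

/-- The path is listed backwards with current end `x`, and its vertices are removed from the
coalition. The invariant is that `x` has at most one neighbour off the path. It passes to the next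
vertex because that vertex already has `x` as a neighbour and its degree is at most two. -/
theorem Represents.marginal_eq_gainVal (h : Represents G w W E)
    (hdeg : ∀ x a b c, G.Adj x a → G.Adj x b → G.Adj x c → a = b ∨ a = c ∨ b = c)
    (S : Finset (Fin n)) (k : ℕ) : ∀ (x : Fin n) (a : ℕ × ℕ) (p : List WVertex),
    ((((x : ℕ), a) :: p).map fun v => v.1).Nodup → (∀ v ∈ p, v.1 < n) → n ≤ k + p.length + 1 →
    (∀ y z, G.Adj x y → G.Adj x z → (∀ v ∈ ((x : ℕ), a) :: p, v.1 ≠ y) →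
      (∀ v ∈ ((x : ℕ), a) :: p, v.1 ≠ z) → y = z) →
    marginal w (rest S (((x : ℕ), a) :: p)) x =
      gainVal (before S (walk E k (((x : ℕ), a) :: p))) := by
  induction k with
  | zero =>
    intro x a p hnd hlt hlen _
    -- With no steps left, the path has at least n different vertices and hence contains every
    -- vertex, so the remaining coalition is empty.
    have hall : ∀ y : Fin n, ∃ v ∈ ((x : ℕ), a) :: p, v.1 = y := by
      intro y
      have hsub : ((((x : ℕ), a) :: p).map fun v => v.1).toFinset ⊆ Finset.range n := by
        intro m hm
        simp only [List.map_cons, List.toFinset_cons, Finset.mem_insert, List.mem_toFinset,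
          List.mem_map] at hm
        rcases hm with rfl | ⟨v, hv, rfl⟩
        · exact Finset.mem_range.2 x.2
        · exact Finset.mem_range.2 (hlt v hv)
      have heq := Finset.eq_of_subset_of_card_le hsub (by
        rw [List.toFinset_card_of_nodup hnd, Finset.card_range]
        simpa using hlen)
      have : (y : ℕ) ∈ ((((x : ℕ), a) :: p).map fun v => v.1).toFinset := by
        rw [heq]; exact Finset.mem_range.2 y.2
      simp at this ⊢
      tauto
    refine marginal_eq_zero _ fun z hz => ?_
    obtain ⟨v, hv, hvz⟩ := hall z
    exact absurd hvz ((Finset.mem_filter.1 hz).2 v hv)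
  | succ k ih =>
    intro x a p hnd hlt hlen huniq
    have hxr : x ∉ rest S (((x : ℕ), a) :: p) := by
      simp [rest]
    rw [walk]
    cases hf : findNext E (((x : ℕ), a) :: p) with
    | none =>
      refine marginal_eq_zero _ fun z hz hxz => ?_
      obtain ⟨v, hv, hvz⟩ := h.findNext_eq_none hf hxz
      exact (Finset.mem_filter.1 hz).2 v hv hvz
    | some e =>
      obtain ⟨y, hxy, rfl, hy⟩ := h.findNext_eq_some hf
      rw [Option.elim_some, gainVal_before_cons hy, h.marginal_eq_max hxr hxy hxy, max_self]
      · intro z hz hxz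
        exact .inl (huniq z y hxz hxy (Finset.mem_filter.1 hz).2 hy)
      · refine ih y _ _ ?_ ?_ ?_ ?_
        · rw [List.map_cons, List.nodup_cons]
          refine ⟨fun hm => ?_, hnd⟩
          obtain ⟨v, hv, hvy⟩ := List.mem_map.1 hm
          exact hy v hv hvy
        · intro v hv
          rcases List.mem_cons.1 hv with rfl | hv
          · exact x.2
          · exact hlt v hv
        · simp only [List.length_cons]; omega
        · intro b c hb hc hb' hc'
          have hxb : x ≠ b := fun hh => hb' ((x : ℕ), a) (by simp) (by rw [hh])
          have hxc : x ≠ c := fun hh => hc' ((x : ℕ), a) (by simp) (by rw [hh])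
          rcases hdeg y x b c hxy.symm hb hc with h1 | h1 | h1
          · exact absurd h1 hxb
          · exact absurd h1 hxc
          · exact h1

/-- The start is the only vertex from which two new directions are possible. After the first edge,
each arm satisfies the invariant of `Represents.marginal_eq_gainVal`. -/
theorem Represents.marginal_eq_max_gainVal (h : Represents G w W E)
    (hdeg : ∀ x a b c, G.Adj x a → G.Adj x b → G.Adj x c → a = b ∨ a = c ∨ b = c)
    {i : Fin n} (hlen : (E.filter fun e => decide (e.1 = (i : ℕ))).length ≤ 2)
    {clock : List Symbol} (hc : n ≤ clock.length) {S : Finset (Fin n)} (hi : i ∉ S) :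
    marginal w S i = max (gainVal (before S (arm E clock i)))
      (gainVal (before S (arm E.reverse clock i))) := by
  obtain ⟨k, hk⟩ : ∃ k, clock.length = k + 1 :=
    Nat.exists_eq_succ_of_ne_zero (by have := i.2; omega)
  have hrest : rest S [((i : ℕ), 0, 1)] = S := by
    refine Finset.filter_true_of_mem fun x hx v hv hvx => hi ?_
    rw [List.mem_singleton] at hv
    subst hv
    exact Fin.val_injective hvx ▸ hx
  set c : WEdge → Bool := fun e => decide (e.1 = i) && !decide ((i : ℕ) = e.2.1) with hcdef
  have hf : ∀ E, findNext E [((i : ℕ), 0, 1)] = (E.filter c).head? := by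
    intro E
    rw [List.head?_filter]
    simp [findNext, hcdef]
    rfl
  have hlen2 : (E.filter c).length ≤ 2 := by
    refine le_trans (List.Sublist.length_le ?_) hlen
    exact List.monotone_filter_right _ fun e he => by
      simp only [hcdef, Bool.and_eq_true] at he
      exact he.1
  have hnb : ∀ z, G.Adj i z → ((i : ℕ), (z : ℕ), W i z) ∈ E.filter c := by
    intro z hz
    refine List.mem_filter.2 ⟨(h.mem_iff _).2 ⟨i, z, hz, rfl⟩, ?_⟩
    simpa [hcdef, Fin.val_inj] using hz.ne
  have hstep : ∀ E', Represents G w W E' → ∀ e, (E'.filter c).head? = some e →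
      ∃ y, G.Adj i y ∧ e = ((i : ℕ), (y : ℕ), W i y) ∧
        gainVal (before S (arm E' clock i)) = edgeGain w W S i y := by
    intro E' h' e he
    rw [← hf] at he
    obtain ⟨y, hiy, rfl, hy⟩ := h'.findNext_eq_some he
    refine ⟨y, hiy, rfl, ?_⟩
    rw [arm_eq_walk, hk, walk, he, Option.elim_some]
    conv_rhs => rw [← hrest]
    refine gainVal_before_cons hy (h'.marginal_eq_gainVal hdeg S k y _ _ ?_ ?_ ?_ ?_)
    · simpa using fun hh => hiy.ne (Fin.val_injective hh).symm
    · intro v hv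
      rw [List.mem_singleton] at hv
      subst hv
      exact i.2
    · simp only [List.length_singleton]; omega
    · intro b d hb hd hb' hd'
      have hxb : i ≠ b := fun hh => hb' ((i : ℕ), 0, 1) (by simp) (by rw [hh])
      have hxd : i ≠ d := fun hh => hd' ((i : ℕ), 0, 1) (by simp) (by rw [hh])
      rcases hdeg y i b d hiy.symm hb hd with h1 | h1 | h1
      · exact absurd h1 hxb
      · exact absurd h1 hxd
      · exact h1
  have hfr : E.reverse.filter c = (E.filter c).reverse := List.filter_reverse
  -- With two edges at `i`, the search finds the first one in `E` and the second one in `E.reverse`.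
  -- With one edge both arms start alike, and the maximum of equal gains is harmless.
  rcases hl : E.filter c with _ | ⟨e₁, _ | ⟨e₂, _ | ⟨e₃, l⟩⟩⟩
  · have h1 : findNext E [((i : ℕ), 0, 1)] = none := by rw [hf, hl]; rfl
    have h2 : findNext E.reverse [((i : ℕ), 0, 1)] = none := by rw [hf, hfr, hl]; rfl
    rw [arm_eq_walk, arm_eq_walk, hk, walk, walk, h1, h2]
    rw [marginal_eq_zero S fun z _ hz => by
      have := hnb z hz
      rw [hl] at this
      simp at this]
    simp [before, gainVal]
  · obtain ⟨y, hy, hey, hg⟩ := hstep E h e₁ (by rw [hl]; rfl)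
    obtain ⟨y', hy', hey', hg'⟩ := hstep E.reverse h.reverse e₁ (by rw [hfr, hl]; rfl)
    rw [hg, hg']
    refine h.marginal_eq_max hi hy hy' fun z _ hz => .inl ?_
    have := hnb z hz
    rw [hl, hey] at this
    simp only [List.mem_singleton, Prod.mk.injEq, true_and] at this
    exact Fin.val_injective this.1
  · obtain ⟨y, hy, hey, hg⟩ := hstep E h e₁ (by rw [hl]; rfl)
    obtain ⟨y', hy', hey', hg'⟩ := hstep E.reverse h.reverse e₂ (by rw [hfr, hl]; rfl)
    rw [hg, hg']
    refine h.marginal_eq_max hi hy hy' fun z _ hz => ?_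
    have := hnb z hz
    rw [hl, hey, hey'] at this
    simp only [List.mem_cons, List.not_mem_nil, or_false, Prod.mk.injEq, true_and] at this
    exact this.imp (fun hh => Fin.val_injective hh.1) (fun hh => Fin.val_injective hh.1)
  · rw [hl] at hlen2
    simp at hlen2

end

end MatchingGame

/-! ### Averaging over coalitions and correctness of the sum of fractions. -/

namespace MatchingGame

/-- The sign denoted by a truth value. -/
noncomputable def signVal (b : Bool) : ℝ := cond b 1 (-1)

/-- The value of a term. -/
noncomputable def termVal (t : Term) : ℝ := signVal t.1 * fracVal t.2

theorem sumTerms_spec (l : List Term) (hl : ∀ t ∈ l, t.2.2 ≠ 0) : (sumTerms l).2.2 ≠ 0 ∧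
    (((sumTerms l).1 : ℝ) - (sumTerms l).2.1) / (sumTerms l).2.2 = (l.map termVal).sum := by
  have key : ∀ (l : List Term), (∀ t ∈ l, t.2.2 ≠ 0) → ∀ s : ℕ × ℕ × ℕ, s.2.2 ≠ 0 →
      (l.foldl (fun s t => (s.1 * t.2.2 + cond t.1 (t.2.1 * s.2.2) 0,
        s.2.1 * t.2.2 + cond t.1 0 (t.2.1 * s.2.2), s.2.2 * t.2.2)) s).2.2 ≠ 0 ∧
      (((l.foldl (fun s t => (s.1 * t.2.2 + cond t.1 (t.2.1 * s.2.2) 0,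
        s.2.1 * t.2.2 + cond t.1 0 (t.2.1 * s.2.2), s.2.2 * t.2.2)) s).1 : ℝ) -
      (l.foldl (fun s t => (s.1 * t.2.2 + cond t.1 (t.2.1 * s.2.2) 0,
        s.2.1 * t.2.2 + cond t.1 0 (t.2.1 * s.2.2), s.2.2 * t.2.2)) s).2.1) /
      (l.foldl (fun s t => (s.1 * t.2.2 + cond t.1 (t.2.1 * s.2.2) 0,
        s.2.1 * t.2.2 + cond t.1 0 (t.2.1 * s.2.2), s.2.2 * t.2.2)) s).2.2 =
      ((s.1 : ℝ) - s.2.1) / s.2.2 + (l.map termVal).sum := by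
    intro l
    induction l with
    | nil => intro _ s hs; simpa using hs
    | cons t l ih =>
      intro hl s hs
      have ht := hl t (by simp)
      obtain ⟨h1, h2⟩ := ih (fun u hu => hl u (by simp [hu]))
        (s.1 * t.2.2 + cond t.1 (t.2.1 * s.2.2) 0,
          s.2.1 * t.2.2 + cond t.1 0 (t.2.1 * s.2.2), s.2.2 * t.2.2) (mul_ne_zero hs ht)
      refine ⟨h1, ?_⟩
      rw [List.foldl_cons, h2, List.map_cons, List.sum_cons, ← add_assoc]
      congr 1
      have hs' : (s.2.2 : ℝ) ≠ 0 := Nat.cast_ne_zero.2 hs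
      have ht' : (t.2.2 : ℝ) ≠ 0 := Nat.cast_ne_zero.2 ht
      cases hb : t.1 <;> simp only [termVal, signVal, fracVal, hb, cond_true, cond_false] <;>
        push_cast <;> field_simp <;> ring
  have h := key l hl (0, 0, 1) one_ne_zero
  simpa [sumTerms] using h

theorem signedPrefixes_cons (v : WVertex) (p : List WVertex) :
    signedPrefixes (v :: p) = (true, [], []) :: (false, [], [v]) ::
      (signedPrefixes p).map fun x => (x.1, v :: x.2.1, v :: x.2.2) := by
  simp [signedPrefixes, List.range_succ_eq_map, List.flatMap_map, List.map_flatMap]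

theorem subset_of_mem_signedPrefixes {p : List WVertex} {x : Bool × List WVertex × List WVertex}
    (hx : x ∈ signedPrefixes p) : x.2.1 ⊆ p ∧ x.2.2 ⊆ p := by
  simp only [signedPrefixes, List.mem_append, List.mem_flatMap, List.mem_cons,
    List.not_mem_nil, or_false] at hx
  rcases hx with ⟨k, _, rfl | rfl⟩ | rfl
  · exact ⟨List.take_subset _ _, List.take_subset _ _⟩
  · exact ⟨List.take_subset _ _, List.take_subset _ _⟩
  · exact ⟨List.Subset.refl _, List.Subset.refl _⟩

section

variable {n : ℕ}

open Classical in
/-- Whether all vertices of a list belong to a coalition. -/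
noncomputable def inside (S : Finset (Fin n)) (p : List WVertex) : ℝ :=
  if ∀ v ∈ p, v.1 ∈ S.image Fin.val then 1 else 0

theorem inside_append (S : Finset (Fin n)) (p q : List WVertex) :
    inside S (p ++ q) = inside S p * inside S q := by
  unfold inside
  simp only [List.mem_append, or_imp, forall_and, ite_and, ite_mul, one_mul, zero_mul]

/-- Telescoping. If the first vertex is in `S`, the two leading terms cancel and the induction
hypothesis applies to `F (v :: ·)`; otherwise only the term `F []` survives. -/
theorem sum_signedPrefixes (S : Finset (Fin n)) (p : List WVertex) (F : List WVertex → ℝ) :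
    ((signedPrefixes p).map fun x => signVal x.1 * F x.2.1 * inside S x.2.2).sum =
      F (before S p) := by
  induction p generalizing F with
  | nil => simp [signedPrefixes, signVal, inside, before]
  | cons v p ih =>
    have hcons : ∀ q, inside S (v :: q) = inside S [v] * inside S q := fun q =>
      inside_append S [v] q
    rw [signedPrefixes_cons, List.map_cons, List.map_cons, List.sum_cons, List.sum_cons,
      List.map_map]
    have h1 : ((signedPrefixes p).map ((fun x => signVal x.1 * F x.2.1 * inside S x.2.2) ∘
        fun x => (x.1, v :: x.2.1, v :: x.2.2))).sum =
        F (v :: before S p) * inside S [v] := by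
      rw [← ih fun q => F (v :: q), ← List.sum_map_mul_right]
      congr 2
      funext x
      simp only [Function.comp_apply, hcons x.2.2]
      ring
    rw [h1]
    unfold before
    rw [List.takeWhile_cons]
    by_cases hv : v.1 ∈ S.image Fin.val
    · rw [if_pos (by simpa using hv)]
      have h2 : inside S [v] = 1 := if_pos (by simpa using hv)
      have h3 : inside S [] = 1 := if_pos (by simp)
      simp [h2, h3, signVal]
    · rw [if_neg (by simpa using hv)]
      have h2 : inside S [v] = 0 := if_neg (by simpa using hv)
      have h3 : inside S [] = 1 := if_pos (by simp)
      simp [h2, h3, signVal]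

theorem countVertices_eq (p : List WVertex) :
    countVertices p = (p.map fun v => v.1).toFinset.card := by
  have key : ∀ p : List WVertex,
      (p.foldr (fun v s => if s.any (fun u => decide (u = v.1)) = true then s else v.1 :: s)
        []).Nodup ∧
      (p.foldr (fun v s => if s.any (fun u => decide (u = v.1)) = true then s else v.1 :: s)
        []).toFinset = (p.map fun v => v.1).toFinset := by
    intro p
    induction p with
    | nil => simp
    | cons v p ih =>
      rw [List.foldr_cons, List.map_cons, List.toFinset_cons, ← ih.2]
      split_ifs with h
      · refine ⟨ih.1, (Finset.insert_eq_of_mem ?_).symm⟩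
        simpa using h
      · refine ⟨List.nodup_cons.2 ⟨?_, ih.1⟩, by rw [List.toFinset_cons]⟩
        simpa using h
  rw [countVertices, ← (key p).2, List.toFinset_card_of_nodup (key p).1]

theorem sum_coalitions_inside (i : Fin n) (p : List WVertex)
    (hp : ∀ v ∈ p, v.1 < n ∧ v.1 ≠ i) :
    (∑ S ∈ (Finset.univ.erase i).powerset, ((S.card ! : ℝ) *
      ((Fintype.card (Fin n) - S.card - 1)! : ℝ) * inside S p)) / (Fintype.card (Fin n))! =
      1 / ((countVertices p : ℝ) + 1) := by
  classical
  set X : Finset (Fin n) := Finset.univ.filter fun x => ∃ v ∈ p, v.1 = x with hX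
  have hcard : X.card = countVertices p := by
    rw [countVertices_eq, ← Finset.card_image_of_injective X Fin.val_injective]
    congr 1
    ext m
    simp only [hX, Finset.mem_image, Finset.mem_filter, Finset.mem_univ, true_and, List.mem_toFinset,
      List.mem_map]
    constructor
    · rintro ⟨x, ⟨v, hv, hvx⟩, rfl⟩
      exact ⟨v, hv, hvx⟩
    · rintro ⟨v, hv, rfl⟩
      exact ⟨⟨v.1, (hp v hv).1⟩, ⟨v, hv, rfl⟩, rfl⟩
  have hi : i ∉ X := by
    simp only [hX, Finset.mem_filter, Finset.mem_univ, true_and, not_exists, not_and]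
    exact fun v hv => (hp v hv).2
  rw [← hcard, ← sum_coalitions i X hi]
  congr 1
  refine Finset.sum_congr rfl fun S _ => ?_
  congr 1
  unfold inside
  congr 1
  rw [eq_iff_iff]
  constructor
  · intro h x hx
    obtain ⟨v, hv, hvx⟩ := (Finset.mem_filter.1 hx).2
    have := h v hv
    rw [hvx] at this
    exact val_mem_image.1 this
  · intro h v hv
    exact Finset.mem_image.2 ⟨⟨v.1, (hp v hv).1⟩, h (Finset.mem_filter.2
      ⟨Finset.mem_univ _, v, hv, rfl⟩), rfl⟩

/-- Linearity: the Shapley average is taken separately for each indicator. -/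
theorem sum_mul_listSum {ι κ : Type*} (s : Finset ι) (c : ι → ℝ) (d : ℝ) (L : List κ) (f : κ → ℝ)
    (g : ι → κ → ℝ) :
    (∑ S ∈ s, c S * (L.map fun z => f z * g S z).sum) / d =
      (L.map fun z => f z * ((∑ S ∈ s, c S * g S z) / d)).sum := by
  induction L with
  | nil => simp
  | cons z L ih =>
    simp only [List.map_cons, List.sum_cons, mul_add, Finset.sum_add_distrib, add_div, ih]
    congr 1
    rw [← mul_div_assoc, Finset.mul_sum]
    congr 1
    exact Finset.sum_congr rfl fun S _ => by ring

variable {G : SimpleGraph (Fin n)} {w : G.edgeSet → ℝ≥0} {W : Fin n → Fin n → ℕ × ℕ}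
  {E : List WEdge}

theorem Represents.arm_spec (h : Represents G w W E) (clock : List Symbol) (i : Fin n) :
    ∀ v ∈ arm E clock i, v.2.2 ≠ 0 ∧ v.1 < n ∧ v.1 ≠ i := by
  intro v hv
  rw [arm_eq_walk] at hv
  obtain ⟨⟨e, he, rfl⟩, h2⟩ := mem_walk hv
  obtain ⟨x, y, _, rfl⟩ := (h.mem_iff e).1 he
  exact ⟨h.den_ne_zero x y, y.2, (h2 ((i : ℕ), 0, 1) (by simp)).symm⟩

theorem shapleyValue_nonneg (w : G.edgeSet → ℝ≥0) (i : Fin n) :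
    0 ≤ shapleyValue (matchingGame G w) i := by
  refine div_nonneg (Finset.sum_nonneg fun S _ => ?_) (by positivity)
  have := marginal_nonneg w S i
  rw [marginal] at this
  positivity

theorem pairTerm_spec {x y : Bool × List WVertex × List WVertex}
    (hx : ∀ v ∈ x.2.1, v.2.2 ≠ 0) (hy : ∀ v ∈ y.2.1, v.2.2 ≠ 0) :
    (pairTerm x y).2.2 ≠ 0 ∧ termVal (pairTerm x y) =
      signVal x.1 * (signVal y.1 * max (gainVal x.2.1) (gainVal y.2.1)) *
        (1 / ((countVertices (x.2.2 ++ y.2.2) : ℝ) + 1)) := by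
  obtain ⟨h1, h1'⟩ := gain_spec _ hx
  obtain ⟨h2, h2'⟩ := gain_spec _ hy
  obtain ⟨h3, h3'⟩ := fracMax_spec _ _ h1 h2
  rw [h1', h2'] at h3'
  refine ⟨mul_ne_zero h3 (Nat.succ_ne_zero _), ?_⟩
  rw [← h3', termVal, pairTerm]
  simp only [fracVal]
  have hs : signVal (cond x.1 y.1 (!y.1)) = signVal x.1 * signVal y.1 := by
    cases x.1 <;> cases y.1 <;> simp [signVal]
  rw [hs]
  push_cast
  field_simp

/-- The marginal contribution is expanded over the initial segments of both arms. Each product of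
indicators is the indicator that a set `X` of vertices lies in the coalition, which averages to
1/(|X| + 1). -/
theorem Represents.solveEdges_spec (h : Represents G w W E)
    (hdeg : ∀ x a b c, G.Adj x a → G.Adj x b → G.Adj x c → a = b ∨ a = c ∨ b = c)
    {i : Fin n} (hlen : (E.filter fun e => decide (e.1 = (i : ℕ))).length ≤ 2)
    {clock : List Symbol} (hc : n ≤ clock.length) :
    (solveEdges E clock i).2 ≠ 0 ∧
      shapleyValue (matchingGame G w) i = fracVal (solveEdges E clock i) := by
  set P := arm E clock i with hP
  set Q := arm E.reverse clock i with hQ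
  have hPs := h.arm_spec clock i
  have hQs := h.reverse.arm_spec clock i
  rw [← hP] at hPs
  rw [← hQ] at hQs
  set L := (signedPrefixes P).flatMap fun x => (signedPrefixes Q).map fun y => (x, y) with hL
  have hLmem : ∀ z ∈ L, (∀ v ∈ z.1.2.1, v ∈ P) ∧ (∀ v ∈ z.1.2.2, v ∈ P) ∧
      (∀ v ∈ z.2.2.1, v ∈ Q) ∧ (∀ v ∈ z.2.2.2, v ∈ Q) := by
    intro z hz
    simp only [hL, List.mem_flatMap, List.mem_map] at hz
    obtain ⟨x, hx, y, hy, rfl⟩ := hz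
    have h1 := subset_of_mem_signedPrefixes hx
    have h2 := subset_of_mem_signedPrefixes hy
    exact ⟨h1.1, h1.2, h2.1, h2.2⟩
  have hpair : pairTerms P Q = L.map fun z => pairTerm z.1 z.2 := by
    simp [hL, pairTerms, List.map_flatMap, Function.comp_def]
  have hterm : ∀ z ∈ L, (pairTerm z.1 z.2).2.2 ≠ 0 ∧ termVal (pairTerm z.1 z.2) =
      signVal z.1.1 * (signVal z.2.1 * max (gainVal z.1.2.1) (gainVal z.2.2.1)) *
        (1 / ((countVertices (z.1.2.2 ++ z.2.2.2) : ℝ) + 1)) := fun z hz =>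
    pairTerm_spec (fun v hv => (hPs v ((hLmem z hz).1 v hv)).1)
      (fun v hv => (hQs v ((hLmem z hz).2.2.1 v hv)).1)
  have hmarg : ∀ S ∈ (Finset.univ.erase i).powerset,
      matchingGame G w (insert i S) - matchingGame G w S =
      (L.map fun z => signVal z.1.1 * (signVal z.2.1 * max (gainVal z.1.2.1) (gainVal z.2.2.1)) *
        inside S (z.1.2.2 ++ z.2.2.2)).sum := by
    intro S hS
    have hiS : i ∉ S := fun hi => by simpa using Finset.mem_powerset.1 hS hi
    have h1 := h.marginal_eq_max_gainVal hdeg hlen hc hiS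
    rw [marginal] at h1
    -- The expansion is carried out in the first arm with the segment of the second one fixed, and
    -- then in the second arm for each term.
    rw [h1, ← sum_signedPrefixes S P fun p => max (gainVal p) (gainVal (before S Q)), hL,
      List.map_flatMap, List.flatMap, List.sum_flatten, List.map_map]
    congr 2
    funext x
    rw [← sum_signedPrefixes S Q fun q => max (gainVal x.2.1) (gainVal q), mul_comm (signVal x.1),
      mul_assoc, ← List.sum_map_mul_right, Function.comp_apply, List.map_map]
    congr 2
    funext y
    simp only [Function.comp_apply, inside_append]
    ring
  have hval : shapleyValue (matchingGame G w) i = ((pairTerms P Q).map termVal).sum := by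
    rw [shapleyValue, Finset.sum_congr rfl fun S hS => by rw [hmarg S hS], sum_mul_listSum, hpair,
      List.map_map]
    congr 1
    refine List.map_congr_left fun z hz => ?_
    rw [Function.comp_apply, (hterm z hz).2, sum_coalitions_inside]
    intro v hv
    rcases List.mem_append.1 hv with hv | hv
    · exact (hPs v ((hLmem z hz).2.1 v hv)).2
    · exact (hQs v ((hLmem z hz).2.2.2 v hv)).2
  obtain ⟨h1, h2⟩ := sumTerms_spec (pairTerms P Q) (by
    rw [hpair]
    intro t ht
    obtain ⟨z, hz, rfl⟩ := List.mem_map.1 ht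
    exact (hterm z hz).1)
  refine ⟨h1, ?_⟩
  -- Nonnegativity ensures that the negative part does not exceed the positive part, so the
  -- truncated subtraction in `finish` is exact.
  have h0 := shapleyValue_nonneg w i
  rw [hval, ← h2] at h0 ⊢
  have hpos : (0 : ℝ) < (sumTerms (pairTerms P Q)).2.2 := Nat.cast_pos.2 (Nat.pos_of_ne_zero h1)
  rw [le_div_iff₀ hpos, zero_mul, sub_nonneg, Nat.cast_le] at h0
  rw [← Nat.cast_sub h0]
  rfl

end

end MatchingGame

/-! ### The algorithm applied to encoded instances -/

namespace MatchingGame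

theorem chunks_append (c : Symbol) (l r : List Symbol) (h : c ∉ l) :
    chunks c (l ++ c :: r) = l :: chunks c r := by
  induction l with
  | nil => simp [chunks]
  | cons s l ih =>
    simp only [List.mem_cons, not_or] at h
    have := ih h.2
    unfold chunks at this ⊢
    rw [List.cons_append, List.foldr_cons, this, if_neg (Ne.symm h.1)]

theorem chunks_flatMap {α : Type} (c : Symbol) (l : List α) (f : α → List Symbol)
    (h : ∀ x, c ∉ f x) : chunks c (l.flatMap fun x => f x ++ [c]) = l.map f := by
  induction l with
  | nil => rfl
  | cons x l ih =>
    rw [List.flatMap_cons, List.append_assoc, List.singleton_append, chunks_append c _ _ (h x), ih,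
      List.map_cons]

theorem bitsValue_encodeNat (k : ℕ) : bitsValue (encodeNat k) = k := by
  have : (encodeNat k).map (fun s => decide (s = .bit true)) = k.bits := by
    rw [encodeNat, List.map_map]
    conv_rhs => rw [← List.map_id k.bits]
    refine List.map_congr_left fun b _ => ?_
    cases b <;> rfl
  rw [bitsValue, this, StackProg.ofBits_bits_reverse]

theorem notMem_encodeNat {s : Symbol} (hs : ∀ b, s ≠ .bit b) (k : ℕ) : s ∉ encodeNat k := by
  intro h
  obtain ⟨b, _, hb⟩ := List.mem_map.1 h
  exact hs b hb.symm

theorem entryEdge_encodeFraction (x y a b : ℕ) :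
    entryEdge x y (encodeFraction (a, b)) = [(x, y, a, b)] := by
  have h : chunks .slash (encodeFraction (a, b) ++ [.slash]) = [encodeNat a, encodeNat b] := by
    rw [encodeFraction, List.append_assoc, List.cons_append,
      chunks_append _ _ _ (notMem_encodeNat (by simp) a),
      chunks_append _ _ _ (notMem_encodeNat (by simp) b)]
    rfl
  rw [entryEdge, h]
  simp [chunksEdge, bitsValue_encodeNat]

theorem zipIdx_finRange (n : ℕ) :
    (List.finRange n).zipIdx = (List.finRange n).map fun x : Fin n => (x, (x : ℕ)) := by
  apply List.ext_getElem <;> simp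

theorem flatMap_zipIdx_finRange {α β : Type} (n : ℕ) (f : Fin n → α) (g : α → ℕ → List β) :
    (((List.finRange n).map f).zipIdx.flatMap fun r => g r.1 r.2) =
      (List.finRange n).flatMap fun x => g (f x) x := by
  rw [List.zipIdx_map, zipIdx_finRange, List.map_map, List.flatMap_map]
  rfl

namespace Instance

open Classical in
/-- The weight of an edge as a fraction. -/
noncomputable def weightFrac (I : Instance) (x y : Fin I.n) : ℕ × ℕ :=
  if h : s(x, y) ∈ I.graph.edgeSet then ((I.weight ⟨s(x, y), h⟩).num, (I.weight ⟨s(x, y), h⟩).den)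
  else (0, 1)

open Classical in
/-- The entry of the adjacency matrix without its end mark. -/
noncomputable def entry (I : Instance) (x y : Fin I.n) : List Symbol :=
  if I.graph.Adj x y then encodeFraction (I.weightFrac x y) else [.nonEdge]

theorem encodeEntry_eq (I : Instance) (x y : Fin I.n) :
    I.encodeEntry x y = I.entry x y ++ [.endEntry] := by
  unfold encodeEntry entry weightFrac
  by_cases h : s(x, y) ∈ I.graph.edgeSet
  · have h' : I.graph.Adj x y := h
    simp [h']
  · have h' : ¬ I.graph.Adj x y := h
    simp [h']

/-- Each separator is absent from the parts it separates, so that `chunks` recovers rows and entries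
unambiguously. -/
theorem notMem_entry (I : Instance) {s : Symbol} (hs : ∀ b, s ≠ .bit b) (h1 : s ≠ .slash)
    (h2 : s ≠ .nonEdge) (x y : Fin I.n) : s ∉ I.entry x y := by
  unfold entry encodeFraction
  split_ifs
  · simp only [List.mem_append, List.mem_cons, not_or]
    exact ⟨notMem_encodeNat hs _, h1, notMem_encodeNat hs _⟩
  · simpa using h2

/-- The list of vertices, with the player marked. -/
def header (I : Instance) : List Symbol :=
  (List.finRange I.n).map fun x => if x = I.player then .player else .vertex

/-- A row of the adjacency matrix without its end mark. -/
noncomputable def row (I : Instance) (x : Fin I.n) : List Symbol :=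
  (List.finRange I.n).flatMap fun y => I.entry x y ++ [.endEntry]

theorem encode_eq (I : Instance) :
    I.encode = I.header ++ (List.finRange I.n).flatMap fun x => I.row x ++ [.endRow] := by
  simp only [encode, encodeEntry_eq, header, row]

theorem notMem_row (I : Instance) {s : Symbol} (hs : ∀ b, s ≠ .bit b) (h1 : s ≠ .slash)
    (h2 : s ≠ .nonEdge) (h3 : s ≠ .endEntry) (x : Fin I.n) : s ∉ I.row x := by
  unfold row
  simp only [List.mem_flatMap, List.mem_append, List.mem_singleton, not_exists, not_and, not_or]
  exact fun y _ => ⟨I.notMem_entry hs h1 h2 x y, h3⟩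

theorem isVertexMark_header (I : Instance) : ∀ s ∈ I.header, isVertexMark s = true := by
  intro s hs
  obtain ⟨x, _, rfl⟩ := List.mem_map.1 hs
  split_ifs <;> rfl

theorem isVertexMark_rows (I : Instance) :
    ∀ s ∈ (List.finRange I.n).flatMap (fun x => I.row x ++ [Symbol.endRow]),
      isVertexMark s = false := by
  intro s hs
  obtain ⟨x, _, hx⟩ := List.mem_flatMap.1 hs
  cases s <;> try rfl
  · simp [I.notMem_row (s := .vertex)] at hx
  · simp [I.notMem_row (s := .player)] at hx

theorem stringVertices_encode (I : Instance) : stringVertices I.encode = I.header := by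
  rw [encode_eq, stringVertices, List.filter_append,
    List.filter_eq_self.2 I.isVertexMark_header, List.filter_eq_nil_iff.2, List.append_nil]
  intro s hs
  simp [I.isVertexMark_rows s hs]

theorem stringPlayer_encode (I : Instance) : stringPlayer I.encode = I.player := by
  rw [stringPlayer, stringVertices_encode, header, List.zipIdx_map, zipIdx_finRange, List.map_map]
  cases h : List.find? (fun p : Symbol × ℕ => decide (p.1 = .player)) _ with
  | none =>
    have := List.find?_eq_none.1 h (.player, I.player)
      (List.mem_map.2 ⟨I.player, List.mem_finRange _, by simp⟩)
    simp at this
  | some p =>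
    obtain ⟨x, _, rfl⟩ := List.mem_map.1 (List.mem_of_find?_eq_some h)
    have := List.find?_some h
    simp only [Function.comp_apply, Prod.map_fst, decide_eq_true_eq, ite_eq_left_iff,
      reduceCtorEq, imp_false, not_not] at this
    subst this
    rfl

open Classical in
theorem stringEdges_encode (I : Instance) :
    stringEdges I.encode = (List.finRange I.n).flatMap fun x => (List.finRange I.n).flatMap fun y =>
      if I.graph.Adj x y then [((x : ℕ), (y : ℕ), I.weightFrac x y)] else [] := by
  have h1 : I.encode.filter (fun s => !isVertexMark s) =
      (List.finRange I.n).flatMap fun x => I.row x ++ [.endRow] := by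
    rw [encode_eq, List.filter_append, List.filter_eq_nil_iff.2, List.nil_append,
      List.filter_eq_self.2]
    · intro s hs
      simp [I.isVertexMark_rows s hs]
    · intro s hs
      simp [I.isVertexMark_header s hs]
  have h2 : ∀ x, chunks .endEntry (I.row x) = (List.finRange I.n).map (I.entry x) := fun x =>
    chunks_flatMap _ _ _ fun y => I.notMem_entry (by simp) (by simp) (by simp) x y
  rw [stringEdges, h1, chunks_flatMap _ _ _ fun x =>
      I.notMem_row (by simp) (by simp) (by simp) (by simp) x,
    flatMap_zipIdx_finRange I.n I.row fun r x =>
      (chunks .endEntry r).zipIdx.flatMap fun e => entryEdge x e.2 e.1]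
  congr 1
  funext x
  rw [h2, flatMap_zipIdx_finRange I.n (I.entry x) fun e y => entryEdge x y e]
  congr 1
  funext y
  unfold entry
  split_ifs with h
  · exact entryEdge_encodeFraction _ _ _ _
  · simp [entryEdge, chunks, chunksEdge]

theorem represents (I : Instance) :
    Represents I.graph (fun e => (I.weight e : ℝ≥0)) I.weightFrac (stringEdges I.encode) := by
  refine ⟨fun e => ?_, fun x y => ?_, fun x y h => ?_⟩
  · rw [stringEdges_encode]
    simp only [List.mem_flatMap, List.mem_finRange, true_and]
    refine exists_congr fun x => exists_congr fun y => ?_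
    split_ifs with h <;> simp [h]
  · unfold weightFrac
    split_ifs
    · exact (I.weight _).den_ne_zero
    · exact one_ne_zero
  · rw [weightFrac, dif_pos h, fracVal]
    have := NNRat.cast_def (K := ℝ) (I.weight ⟨s(x, y), h⟩)
    rw [← this]
    rfl

theorem eq_of_adj (I : Instance) (hI : I.MaxDegreeLeTwo) (x a b c : Fin I.n)
    (ha : I.graph.Adj x a) (hb : I.graph.Adj x b) (hc : I.graph.Adj x c) :
    a = b ∨ a = c ∨ b = c := by
  classical
  by_contra! h
  have h1 := hI x
  rw [← SimpleGraph.card_neighborFinset_eq_degree] at h1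
  have h2 : ({a, b, c} : Finset (Fin I.n)).card ≤ 2 := by
    refine le_trans (Finset.card_le_card ?_) h1
    intro y hy
    simp only [Finset.mem_insert, Finset.mem_singleton] at hy
    rw [SimpleGraph.mem_neighborFinset]
    rcases hy with rfl | rfl | rfl <;> assumption
  rw [Finset.card_eq_three.2 ⟨a, b, c, h.1, h.2.1, h.2.2, rfl⟩] at h2
  omega

/-- Only row `i` of the matrix contributes edges starting at `i`, and it contributes as many as the
degree of `i`. -/
theorem length_filter_le (I : Instance) (hI : I.MaxDegreeLeTwo) (i : Fin I.n) :
    ((stringEdges I.encode).filter fun e => decide (e.1 = (i : ℕ))).length ≤ 2 := by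
  classical
  rw [stringEdges_encode, ← List.countP_eq_length_filter, List.countP_flatMap, ← Fin.sum_univ_def]
  have h1 : ∀ x : Fin I.n, (List.countP (fun e : WEdge => decide (e.1 = (i : ℕ))) ∘ fun x =>
      (List.finRange I.n).flatMap fun y =>
        if I.graph.Adj x y then [((x : ℕ), (y : ℕ), I.weightFrac x y)] else []) x =
      if x = i then I.graph.degree x else 0 := by
    intro x
    rw [Function.comp_apply, List.countP_flatMap, ← Fin.sum_univ_def,
      ← SimpleGraph.card_neighborFinset_eq_degree, SimpleGraph.neighborFinset_eq_filter]
    split_ifs with hx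
    · subst hx
      rw [Finset.card_filter]
      refine Finset.sum_congr rfl fun y _ => ?_
      rw [Function.comp_apply]
      split_ifs <;> simp
    · refine Finset.sum_eq_zero fun y _ => ?_
      rw [Function.comp_apply]
      split_ifs <;> simp [Fin.val_inj, hx]
  rw [Finset.sum_congr rfl fun x _ => h1 x, Finset.sum_ite_eq' Finset.univ i]
  simp only [Finset.mem_univ, if_true]
  convert! hI i

theorem solve_encode (I : Instance) (hI : I.MaxDegreeLeTwo) :
    (solve I.encode).2 ≠ 0 ∧
      I.answer = ((solve I.encode).1 : ℝ) / ((solve I.encode).2 : ℝ) := by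
  have h := I.represents.solveEdges_spec (I.eq_of_adj hI) (I.length_filter_le hI I.player)
    (clock := stringVertices I.encode) (by rw [stringVertices_encode]; simp [header])
  rw [← stringPlayer_encode] at h
  exact h

end Instance

end MatchingGame

theorem mainTheorem4 :
    ∃ f : {I : MatchingGame.Instance // I.MaxDegreeLeTwo} → ℕ × ℕ,
      (∀ I, (f I).2 ≠ 0 ∧ I.1.answer = ((f I).1 : ℝ) / ((f I).2 : ℝ)) ∧
      Nonempty (Turing.TM2ComputableInPolyTime
        (fun I : {I : MatchingGame.Instance // I.MaxDegreeLeTwo} => I.1.encode)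
        MatchingGame.encodeFraction f) :=
  ⟨fun I => MatchingGame.solve I.1.encode, fun I => I.1.solve_encode I.2,
    StackProg.PolyTime.computable
      (StackProg.PolyTime.encodeFraction.comp StackProg.PolyTime.solve) fun _ => rfl⟩
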